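/- Let $1<p<\infty$ and let $q$ be the conjugate exponent, $\frac1p+\frac1q=1$. Let $L^p_{loc}(\mathbb R^+)$, $\mathbb R^+=[0,\infty)$, be the Fréchet space of all (classes modulo a.e. equality of) measurable functions $f:\mathbb R^+\to\mathbb C$ with $$q_j(f):=\Big(\int_0^j|f(x)|^p\,dx\Big)^{1/p}<\infty\qquad\text{for all } j\in\mathbb N,$$ endowed with the locally convex topology generated by the seminorms $q_j$, $j\in\mathbb N$. Let $\mathsf C$ be the Cesàro operator, i.e. the continuous linear operator on $L^p_{loc}(\mathbb R^+)$ given by $\mathsf Cf(x)=\frac1x\int_0^x f(t)\,dt$ for $x>0$. Then: 1. $\mathsf C$ is not power bounded, i.e. $\{\mathsf C^n:n\ge 1\}$ is not equicontinuous. 2. $\mathsf C$ is not mean ergodic, i.e. the means $\frac1n\sum_{m=1}^n\mathsf C^m$ do not converge, as $n\to\infty$, to a continuous linear operator in the strong operator topology (pointwise on $L^p_{loc}(\mathbb R^+)$). 3. $\mathsf C$ is hypercyclic, i.e. there is $f\in L^p_{loc}(\mathbb R^+)$ whose orbit $\{\mathsf C^nf:n\ge 0\}$ is dense. 4. $\mathsf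 C$ is chaotic, i.e. it is hypercyclic and its periodic points $\{f:\exists\, n\ge 1,\ \mathsf C^nf=f\}$ are dense. 5. The spectrum of $\mathsf C$, i.e. the set of $\lambda\in\mathbb C$ for which $\lambda I-\mathsf C$ has no inverse among the continuous linear operators on $L^p_{loc}(\mathbb R^+)$, is $\{\lambda\in\mathbb C:|\lambda-\frac q2|\le\frac q2\}$. 6. The point spectrum of $\mathsf C$, i.e. the set of $\lambda\in\mathbb C$ for which $\lambda I-\mathsf C$ is not injective, is $\{\lambda\in\mathbb C:|\lambda-\frac q2|<\frac q2\}$. -/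

import Mathlib

open MeasureTheory Set
open scoped ENNReal

/-- `∫₀ˣ t^(-1/p) dt = q x^(1/q)`. -/
theorem hardy_aux_near {p q : ℝ} (h : p.HolderConjugate q) {x : ℝ} (hx : 0 < x) :
    ∫⁻ t in Ioc 0 x, ENNReal.ofReal (t ^ (-(1 / p))) = ENNReal.ofReal (q * x ^ (1 / q)) := by
  have hp : 1 < p := h.lt
  have hpq := h.inv_add_inv_eq_one
  have hp1 : p⁻¹ < 1 := inv_lt_one_of_one_lt₀ hp
  have hr : -1 < -(1 / p) := by rw [one_div]; linarith
  have hint := intervalIntegral.intervalIntegrable_rpow' (a := 0) (b := x) hr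
  rw [intervalIntegrable_iff_integrableOn_Ioc_of_le hx.le] at hint
  rw [← ofReal_integral_eq_lintegral_ofReal hint
    ((ae_restrict_iff' measurableSet_Ioc).2 (.of_forall fun t ht => Real.rpow_nonneg ht.1.le _)),
    ← intervalIntegral.integral_of_le hx.le, integral_rpow (Or.inl hr)]
  have e : -(1 / p) + 1 = 1 / q := by rw [one_div, one_div]; linarith
  have hq : 0 < q := h.symm.pos
  rw [e, Real.zero_rpow (by positivity)]
  congr 1
  field_simp
  ring

/-- `∫_t^∞ x^(-1-1/q) dx = q t^(-1/q)`. -/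
theorem hardy_aux_far {p q : ℝ} (h : p.HolderConjugate q) {t : ℝ} (ht : 0 < t) :
    ∫⁻ x in Ioi t, ENNReal.ofReal (x ^ (-1 - 1 / q)) = ENNReal.ofReal (q * t ^ (-(1 / q))) := by
  have hq : 0 < q := h.symm.pos
  have hr : -1 - 1 / q < -1 := by have : 0 < 1 / q := by positivity
                                  linarith
  rw [← ofReal_integral_eq_lintegral_ofReal (integrableOn_Ioi_rpow_of_lt hr ht)
    ((ae_restrict_iff' measurableSet_Ioi).2 (.of_forall fun x hx =>
      Real.rpow_nonneg (ht.le.trans (le_of_lt hx)) _)),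
    integral_Ioi_rpow_of_lt hr ht]
  have e : -1 - 1 / q + 1 = -(1 / q) := by ring
  rw [e]
  congr 1
  field_simp

/-- The pointwise estimate obtained from Hölder's inequality with power weights. -/
theorem hardy_pointwise {p q : ℝ} (h : p.HolderConjugate q) {g : ℝ → ℝ≥0∞} (hg : Measurable g)
    {x : ℝ} (hx : 0 < x) :
    ((∫⁻ t in Ioc 0 x, g t) / ENNReal.ofReal x) ^ p ≤
      (∫⁻ t in Ioc 0 x, g t ^ p * ENNReal.ofReal (t ^ (1 / q))) *
        ENNReal.ofReal (q ^ (p - 1) * x ^ (-1 - 1 / q)) := by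
  have hp : 0 < p := h.pos
  have hq : 0 < q := h.symm.pos
  have hol := ENNReal.lintegral_mul_le_Lp_mul_Lq (volume.restrict (Ioc 0 x)) h
    (f := fun t => g t * ENNReal.ofReal (t ^ (1 / (p * q))))
    (g := fun t => ENNReal.ofReal (t ^ (-(1 / (p * q))))) (by fun_prop) (by fun_prop)
  have e1 : ∫⁻ t in Ioc 0 x, ((fun t => g t * ENNReal.ofReal (t ^ (1 / (p * q)))) *
      fun t => ENNReal.ofReal (t ^ (-(1 / (p * q))))) t = ∫⁻ t in Ioc 0 x, g t := by
    refine setLIntegral_congr_fun measurableSet_Ioc fun t ht => ?_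
    have h0 : 0 < t ^ (1 / (p * q)) := Real.rpow_pos_of_pos ht.1 _
    simp only [Pi.mul_apply]
    rw [mul_assoc, ← ENNReal.ofReal_mul h0.le, Real.rpow_neg ht.1.le, mul_inv_cancel₀ h0.ne']
    simp
  have e2 : ∫⁻ t in Ioc 0 x, (g t * ENNReal.ofReal (t ^ (1 / (p * q)))) ^ p =
      ∫⁻ t in Ioc 0 x, g t ^ p * ENNReal.ofReal (t ^ (1 / q)) := by
    refine setLIntegral_congr_fun measurableSet_Ioc fun t ht => ?_
    rw [ENNReal.mul_rpow_of_nonneg _ _ hp.le, ENNReal.ofReal_rpow_of_nonneg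
      (Real.rpow_nonneg ht.1.le _) hp.le, ← Real.rpow_mul ht.1.le]
    congr 3
    field_simp
  have e3 : ∫⁻ t in Ioc 0 x, (ENNReal.ofReal (t ^ (-(1 / (p * q))))) ^ q =
      ENNReal.ofReal (q * x ^ (1 / q)) := by
    rw [← hardy_aux_near h hx]
    refine setLIntegral_congr_fun measurableSet_Ioc fun t ht => ?_
    rw [ENNReal.ofReal_rpow_of_nonneg (Real.rpow_nonneg ht.1.le _) hq.le, ← Real.rpow_mul ht.1.le]
    congr 2
    field_simp
  rw [e1, e2, e3] at hol
  calc ((∫⁻ t in Ioc 0 x, g t) / ENNReal.ofReal x) ^ p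
      ≤ (((∫⁻ t in Ioc 0 x, g t ^ p * ENNReal.ofReal (t ^ (1 / q))) ^ (1 / p) *
          ENNReal.ofReal (q * x ^ (1 / q)) ^ (1 / q)) / ENNReal.ofReal x) ^ p := by gcongr
    _ = _ := by
      have hx1 : 0 < q * x ^ (1 / q) := by positivity
      rw [mul_div_assoc, ENNReal.mul_rpow_of_nonneg _ _ hp.le, ← ENNReal.rpow_mul,
        one_div_mul_cancel hp.ne', ENNReal.rpow_one, ENNReal.ofReal_rpow_of_pos hx1,
        ← ENNReal.ofReal_div_of_pos hx, ENNReal.ofReal_rpow_of_nonneg (by positivity) hp.le]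
      congr 2
      rw [Real.div_rpow (by positivity) hx.le, ← Real.rpow_mul hx1.le,
        Real.mul_rpow hq.le (by positivity), ← Real.rpow_mul hx.le, mul_div_assoc,
        ← Real.rpow_sub hx]
      have hpq := h.inv_add_inv_eq_one
      have hq' : 1 / q = 1 - 1 / p := by rw [one_div, one_div]; linarith
      have a1 : 1 / q * p = p - 1 := by rw [hq']; field_simp
      rw [a1, hq']
      congr 2
      field_simp
      ring

/-- **Hardy's inequality** on `(0, b]`. -/
theorem hardy_lintegral {p q : ℝ} (h : p.HolderConjugate q) {g : ℝ → ℝ≥0∞} (hg : Measurable g)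
    (b : ℝ) :
    ∫⁻ x in Ioc 0 b, ((∫⁻ t in Ioc 0 x, g t) / ENNReal.ofReal x) ^ p ≤
      ENNReal.ofReal (q ^ p) * ∫⁻ t in Ioc 0 b, g t ^ p := by
  have hq : 0 < q := h.symm.pos
  set G : ℝ → ℝ≥0∞ := fun t => g t ^ p * ENNReal.ofReal (t ^ (1 / q)) with hG
  have hGm : Measurable G := by fun_prop
  set c : ℝ → ℝ≥0∞ := fun x => ENNReal.ofReal (q ^ (p - 1) * x ^ (-1 - 1 / q)) with hc
  have hcm : Measurable c := by fun_prop
  set F : ℝ → ℝ → ℝ≥0∞ := fun x t => if t ≤ x then G t * c x else 0 with hF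
  have hFm : Measurable (Function.uncurry F) := by
    refine Measurable.ite (measurableSet_le measurable_snd measurable_fst) ?_ measurable_const
    exact (hGm.comp measurable_snd).mul (hcm.comp measurable_fst)
  calc ∫⁻ x in Ioc 0 b, ((∫⁻ t in Ioc 0 x, g t) / ENNReal.ofReal x) ^ p
      ≤ ∫⁻ x in Ioc 0 b, ∫⁻ t in Ioc 0 b, F x t := by
        refine setLIntegral_mono' measurableSet_Ioc fun x hx => ?_
        refine (hardy_pointwise h hg hx.1).trans (le_of_eq ?_)
        have : ∀ t, F x t = (Iic x).indicator (fun t => G t * c x) t := fun t => by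
          simp [hF, indicator]
        simp_rw [this]
        rw [lintegral_indicator measurableSet_Iic, Measure.restrict_restrict measurableSet_Iic,
          inter_comm, Ioc_inter_Iic, min_eq_right hx.2, lintegral_mul_const _ hGm]
    _ = ∫⁻ t in Ioc 0 b, ∫⁻ x in Ioc 0 b, F x t := lintegral_lintegral_swap hFm.aemeasurable
    _ ≤ ∫⁻ t in Ioc 0 b, ENNReal.ofReal (q ^ p) * g t ^ p := by
        refine setLIntegral_mono' measurableSet_Ioc fun t ht => ?_
        have : ∀ x, F x t = (Ici t).indicator (fun x => G t * c x) x := fun x => by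
          simp [hF, indicator]
        simp_rw [this]
        rw [lintegral_indicator measurableSet_Ici, Measure.restrict_restrict measurableSet_Ici]
        calc ∫⁻ x in Ici t ∩ Ioc 0 b, G t * c x
            ≤ ∫⁻ x in Ici t, G t * c x := lintegral_mono_set inter_subset_left
          _ = ∫⁻ x in Ioi t, G t * c x := by rw [restrict_Ioi_eq_restrict_Ici]
          _ = G t * ENNReal.ofReal (q ^ (p - 1)) * ENNReal.ofReal (q * t ^ (-(1 / q))) := by
            have hcI : ∫⁻ x in Ioi t, c x =
                ENNReal.ofReal (q ^ (p - 1)) * ENNReal.ofReal (q * t ^ (-(1 / q))) := by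
              simp_rw [hc, ENNReal.ofReal_mul (Real.rpow_nonneg hq.le (p - 1))]
              rw [lintegral_const_mul _ (by fun_prop), hardy_aux_far h ht.1]
            rw [lintegral_const_mul _ hcm, hcI, mul_assoc (G t)]
          _ = ENNReal.ofReal (q ^ p) * g t ^ p := by
            have ht0 : 0 < t ^ (1 / q) := Real.rpow_pos_of_pos ht.1 _
            rw [hG, mul_assoc, mul_assoc, ← ENNReal.ofReal_mul (by positivity),
              ← ENNReal.ofReal_mul (by positivity), mul_comm]
            congr 2
            rw [Real.rpow_neg ht.1.le, Real.rpow_sub_one hq.ne']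
            field_simp
    _ = _ := lintegral_const_mul _ (by fun_prop)
/-- Lebesgue measure on the half line `[0, ∞)`, as a measure on `ℝ`. -/
noncomputable abbrev halfLineMeasure : Measure ℝ := volume.restrict (Ici 0)

theorem restrict_Icc_le_halfLine (j : ℕ) :
    (volume.restrict (Icc (0 : ℝ) j)) ≤ halfLineMeasure :=
  Measure.restrict_mono Icc_subset_Ici_self le_rfl

theorem coeFn_ae_Icc {f g : ℝ → ℂ} (h : f =ᵐ[halfLineMeasure] g) (j : ℕ) :
    f =ᵐ[volume.restrict (Icc (0 : ℝ) j)] g :=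
  ae_mono (restrict_Icc_le_halfLine j) h

/-- Classes (modulo equality a.e. on `[0, ∞)`) of measurable functions `f : [0, ∞) → ℂ` with
`∫₀ʲ |f(x)|ᵖ dx < ∞` for all `j ∈ ℕ`. -/
def lpLocSubmodule (p : ℝ) : Submodule ℂ (ℝ →ₘ[halfLineMeasure] ℂ) where
  carrier := {f | ∀ j : ℕ, MemLp f (ENNReal.ofReal p) (volume.restrict (Icc (0 : ℝ) j))}
  zero_mem' j := (memLp_congr_ae (coeFn_ae_Icc AEEqFun.coeFn_zero j)).2 MemLp.zero
  add_mem' {f g} hf hg j :=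
    (memLp_congr_ae (coeFn_ae_Icc (AEEqFun.coeFn_add f g) j)).2 ((hf j).add (hg j))
  smul_mem' c f hf j :=
    (memLp_congr_ae (coeFn_ae_Icc (AEEqFun.coeFn_smul c f) j)).2 ((hf j).const_smul c)

/-- The space `L^p_loc([0, ∞))`. -/
def LpLoc (p : ℝ) : Type := lpLocSubmodule p

namespace LpLoc

noncomputable instance (p : ℝ) : AddCommGroup (LpLoc p) :=
  inferInstanceAs (AddCommGroup (lpLocSubmodule p))

noncomputable instance (p : ℝ) : Module ℂ (LpLoc p) :=
  inferInstanceAs (Module ℂ (lpLocSubmodule p))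

/-- The underlying a.e. class of an element of `LpLoc p`. -/
noncomputable def toAEEqFun (p : ℝ) : LpLoc p →ₗ[ℂ] (ℝ →ₘ[halfLineMeasure] ℂ) := (lpLocSubmodule p).subtype

/-- A representative of a class in `L^p_loc([0, ∞))`; only its values on `[0, ∞)` up to null sets
are meaningful. -/
noncomputable instance (p : ℝ) : CoeFun (LpLoc p) (fun _ => ℝ → ℂ) := ⟨fun f => toAEEqFun p f⟩

variable {p : ℝ}

theorem stronglyMeasurable (f : LpLoc p) : StronglyMeasurable f :=
  (toAEEqFun p f).stronglyMeasurable

theorem memLp (f : LpLoc p) (j : ℕ) :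
    MemLp f (ENNReal.ofReal p) (volume.restrict (Icc (0 : ℝ) j)) := f.2 j

theorem coeFn_add (f g : LpLoc p) : ⇑(f + g) =ᵐ[halfLineMeasure] fun x => f x + g x := by
  rw [map_add]
  exact AEEqFun.coeFn_add _ _

theorem coeFn_smul (c : ℂ) (f : LpLoc p) : ⇑(c • f) =ᵐ[halfLineMeasure] fun x => c * f x := by
  rw [map_smul]
  exact AEEqFun.coeFn_smul c _

theorem ext {f g : LpLoc p} (h : f =ᵐ[halfLineMeasure] g) : f = g :=
  Subtype.ext (AEEqFun.ext h)

theorem one_le_ofReal [hp : Fact (1 < p)] : 1 ≤ ENNReal.ofReal p := by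
  simpa using ENNReal.ofReal_le_ofReal hp.out.le

/-- The seminorms `q_j(f) = (∫₀ʲ |f(x)|ᵖ dx)^(1/p)`. -/
noncomputable def seminorm (p : ℝ) [Fact (1 < p)] : SeminormFamily ℂ (LpLoc p) ℕ := fun j =>
  Seminorm.of
    (fun f => (eLpNorm f (ENNReal.ofReal p) (volume.restrict (Icc (0 : ℝ) j))).toReal)
    (fun f g => by
      rw [eLpNorm_congr_ae (coeFn_ae_Icc (coeFn_add f g) j)]
      rw [← ENNReal.toReal_add (f.memLp j).2.ne (g.memLp j).2.ne]
      exact ENNReal.toReal_mono (ENNReal.add_ne_top.2 ⟨(f.memLp j).2.ne, (g.memLp j).2.ne⟩)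
        (eLpNorm_add_le (f.memLp j).1 (g.memLp j).1 one_le_ofReal))
    (fun c f => by
      rw [eLpNorm_congr_ae (coeFn_ae_Icc (coeFn_smul c f) j)]
      change (eLpNorm (c • ⇑f) _ _).toReal = _
      rw [eLpNorm_const_smul, ENNReal.toReal_mul, toReal_enorm])

/-- `LpLoc p` with the locally convex topology generated by the seminorms `q_j`. -/
noncomputable instance [Fact (1 < p)] : TopologicalSpace (LpLoc p) :=
  (seminorm p).moduleFilterBasis.topology

theorem withSeminorms [Fact (1 < p)] : WithSeminorms (seminorm p) := ⟨rfl⟩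

instance [Fact (1 < p)] : IsTopologicalAddGroup (LpLoc p) := withSeminorms.topologicalAddGroup

instance [Fact (1 < p)] : ContinuousSMul ℂ (LpLoc p) := withSeminorms.continuousSMul

/-- The (translation invariant) uniform structure of the topological vector space `LpLoc p`. -/
noncomputable instance [Fact (1 < p)] : UniformSpace (LpLoc p) :=
  IsTopologicalAddGroup.rightUniformSpace (LpLoc p)

instance [Fact (1 < p)] : IsUniformAddGroup (LpLoc p) := isUniformAddGroup_of_addCommGroup

/-- Functions in `L^p_loc` are integrable on `(0, x]`. -/
theorem integrableOn [Fact (1 < p)] (f : LpLoc p) (x : ℝ) : IntegrableOn f (Ioc 0 x) := by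
  obtain ⟨j, hj⟩ := exists_nat_ge x
  have : IntegrableOn f (Icc (0 : ℝ) j) := (f.memLp j).integrable one_le_ofReal
  exact this.mono_set fun t ht => ⟨ht.1.le, ht.2.trans hj⟩

/-- The Cesàro average `x ↦ (1/x) ∫₀ˣ f(t) dt`. -/
noncomputable def cesaroFun (f : ℝ → ℂ) (x : ℝ) : ℂ := (1 / (x : ℂ)) * ∫ t in (0 : ℝ)..x, f t

theorem cesaroFun_congr {f g : ℝ → ℂ} (h : f =ᵐ[halfLineMeasure] g) {x : ℝ} (hx : 0 ≤ x) :
    cesaroFun f x = cesaroFun g x := by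
  unfold cesaroFun
  rw [intervalIntegral.integral_of_le hx, intervalIntegral.integral_of_le hx,
    setIntegral_congr_ae₀ measurableSet_Ioc.nullMeasurableSet]
  have := (ae_restrict_iff' measurableSet_Ici).1 h
  filter_upwards [this] with t ht ht' using ht ht'.1.le

theorem aestronglyMeasurable_cesaroFun [Fact (1 < p)] (f : LpLoc p) :
    AEStronglyMeasurable (cesaroFun f) halfLineMeasure := by
  set F : ℝ → ℂ := (Ici 0).indicator f with hF
  have hI : ∀ a b, IntervalIntegrable F volume a b := by
    have h0 : ∀ b, IntervalIntegrable F volume 0 b := fun b => by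
      refine ⟨?_, ?_⟩
      · exact (f.integrableOn b).indicator measurableSet_Ici
      · have hs : Ioc b 0 ∩ Ici 0 ⊆ {(0 : ℝ)} := fun t ht => le_antisymm ht.1.2 ht.2
        rw [integrableOn_indicator_iff measurableSet_Ici, inter_comm]
        exact (integrableOn_singleton (hx := by rw [Real.volume_singleton]; exact ENNReal.zero_lt_top)).mono_set hs
    exact fun a b => (h0 a).symm.trans (h0 b)
  have hc : Continuous fun x => ∫ t in (0 : ℝ)..x, F t := intervalIntegral.continuous_primitive hI 0
  have hm : Measurable (cesaroFun F) := by
    unfold cesaroFun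
    exact (measurable_const.div Complex.measurable_ofReal).mul hc.measurable
  refine hm.aestronglyMeasurable.congr ?_
  filter_upwards [ae_restrict_mem measurableSet_Ici] with x hx
  refine cesaroFun_congr ?_ hx
  filter_upwards [ae_restrict_mem measurableSet_Ici] with t ht
  exact indicator_of_mem ht _

theorem eLpNorm_cesaroFun_le [hp : Fact (1 < p)] (f : LpLoc p) (j : ℕ) :
    eLpNorm (cesaroFun f) (ENNReal.ofReal p) (volume.restrict (Icc (0 : ℝ) j)) ≤
      ENNReal.ofReal (p.conjExponent) *
        eLpNorm f (ENNReal.ofReal p) (volume.restrict (Icc (0 : ℝ) j)) := by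
  have hp0 : 0 < p := one_pos.trans hp.out
  have hpq : p.HolderConjugate p.conjExponent := Real.HolderConjugate.conjExponent hp.out
  rw [eLpNorm_eq_lintegral_rpow_enorm_toReal (by simpa using hp0) ENNReal.ofReal_ne_top,
    eLpNorm_eq_lintegral_rpow_enorm_toReal (by simpa using hp0) ENNReal.ofReal_ne_top,
    ENNReal.toReal_ofReal hp0.le, restrict_Ioc_eq_restrict_Icc.symm]
  have hq : ENNReal.ofReal p.conjExponent =
      (ENNReal.ofReal (p.conjExponent ^ p)) ^ (1 / p) := by
    rw [ENNReal.ofReal_rpow_of_nonneg (Real.rpow_nonneg hpq.symm.nonneg _) (by positivity),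
      ← Real.rpow_mul hpq.symm.nonneg, mul_one_div_cancel hp0.ne', Real.rpow_one]
  rw [hq, ← ENNReal.mul_rpow_of_nonneg _ _ (by positivity)]
  gcongr
  refine le_trans ?_ (hardy_lintegral hpq f.stronglyMeasurable.enorm j)
  refine setLIntegral_mono' measurableSet_Ioc fun x hx => ?_
  gcongr
  unfold cesaroFun
  rw [enorm_mul, intervalIntegral.integral_of_le hx.1.le, one_div, mul_comm, ENNReal.div_eq_inv_mul,
    mul_comm]
  gcongr
  · rw [enorm_inv (by exact_mod_cast hx.1.ne'), ← ofReal_norm, Complex.norm_real,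
      Real.norm_of_nonneg hx.1.le]
  · exact enorm_integral_le_lintegral_enorm _

theorem memLp_cesaroFun [Fact (1 < p)] (f : LpLoc p) (j : ℕ) :
    MemLp (cesaroFun f) (ENNReal.ofReal p) (volume.restrict (Icc (0 : ℝ) j)) :=
  ⟨f.aestronglyMeasurable_cesaroFun.mono_measure (restrict_Icc_le_halfLine j),
    (f.eLpNorm_cesaroFun_le j).trans_lt
      (ENNReal.mul_lt_top ENNReal.ofReal_lt_top (f.memLp j).2)⟩

/-- The underlying map of the Cesàro operator. -/
noncomputable def cesaroMap [Fact (1 < p)] (f : LpLoc p) : LpLoc p :=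
  ⟨AEEqFun.mk (cesaroFun f) f.aestronglyMeasurable_cesaroFun, fun j =>
    (memLp_congr_ae (coeFn_ae_Icc (AEEqFun.coeFn_mk _ _) j)).2 (f.memLp_cesaroFun j)⟩

theorem coeFn_cesaroMap [Fact (1 < p)] (f : LpLoc p) :
    ⇑f.cesaroMap =ᵐ[halfLineMeasure] cesaroFun f :=
  AEEqFun.coeFn_mk _ _

/-- The Cesàro operator as a linear map. -/
noncomputable def cesaroLinear (p : ℝ) [Fact (1 < p)] : LpLoc p →ₗ[ℂ] LpLoc p where
  toFun := cesaroMap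
  map_add' f g := by
    apply ext
    filter_upwards [ae_restrict_mem measurableSet_Ici, coeFn_cesaroMap (f + g),
      coeFn_add f.cesaroMap g.cesaroMap, coeFn_cesaroMap f, coeFn_cesaroMap g]
      with x hx h1 h2 h3 h4
    rw [h1, h2, h3, h4, cesaroFun_congr (coeFn_add f g) hx]
    unfold cesaroFun
    rw [intervalIntegral.integral_add
      ((intervalIntegrable_iff_integrableOn_Ioc_of_le hx).2 (f.integrableOn x))
      ((intervalIntegrable_iff_integrableOn_Ioc_of_le hx).2 (g.integrableOn x)), mul_add]
  map_smul' c f := by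
    apply ext
    simp only [RingHom.id_apply]
    filter_upwards [ae_restrict_mem measurableSet_Ici, coeFn_cesaroMap (c • f),
      coeFn_smul c f.cesaroMap, coeFn_cesaroMap f] with x hx h1 h2 h3
    rw [h1, h2, h3, cesaroFun_congr (coeFn_smul c f) hx]
    unfold cesaroFun
    rw [intervalIntegral.integral_const_mul]
    ring

/-- The Cesàro operator `C f(x) = (1/x) ∫₀ˣ f(t) dt` as a continuous linear operator on
`L^p_loc([0, ∞))`, `1 < p < ∞`. -/
noncomputable def cesaro (p : ℝ) [hp : Fact (1 < p)] : LpLoc p →L[ℂ] LpLoc p where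
  toLinearMap := cesaroLinear p
  cont := by
    have hpq : p.HolderConjugate p.conjExponent := Real.HolderConjugate.conjExponent hp.out
    refine WithSeminorms.continuous_of_isBounded withSeminorms withSeminorms (cesaroLinear p) fun j =>
      ⟨{j}, ⟨p.conjExponent, hpq.symm.nonneg⟩, fun f => ?_⟩
    rw [Finset.sup_singleton]
    change (eLpNorm f.cesaroMap _ _).toReal ≤ p.conjExponent * (eLpNorm f _ _).toReal
    rw [eLpNorm_congr_ae (coeFn_ae_Icc (coeFn_cesaroMap f) j)]
    refine (ENNReal.toReal_mono (ENNReal.mul_ne_top ENNReal.ofReal_ne_top (f.memLp j).2.ne)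
      (f.eLpNorm_cesaroFun_le j)).trans ?_
    rw [ENNReal.toReal_mul, ENNReal.toReal_ofReal hpq.symm.nonneg]

theorem coeFn_cesaro [Fact (1 < p)] (f : LpLoc p) :
    ⇑(cesaro p f) =ᵐ[halfLineMeasure] fun x => (1 / (x : ℂ)) * ∫ t in (0 : ℝ)..x, f t :=
  f.coeFn_cesaroMap

end LpLoc

section Dynamics

variable {E : Type*} [AddCommGroup E] [Module ℂ E]

/-- `T` is power bounded: `{T^n : n ≥ 1}` is equicontinuous. -/
def IsPowerBounded [UniformSpace E] (T : E →L[ℂ] E) : Prop :=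
  Equicontinuous fun (n : ℕ) (x : E) => (T ^ (n + 1)) x

variable [TopologicalSpace E]

/-- The Cesàro means `T_[n] = (1/n) ∑_{m=1}^n T^m`. -/
noncomputable def cesaroMean [IsTopologicalAddGroup E] [ContinuousConstSMul ℂ E]
    (T : E →L[ℂ] E) (n : ℕ) : E →L[ℂ] E :=
  (1 / (n : ℂ)) • ∑ m ∈ Finset.Icc 1 n, T ^ m

/-- `T` is mean ergodic: the Cesàro means converge to some continuous linear operator in the
strong operator topology, that is, pointwise. -/
def IsMeanErgodic [IsTopologicalAddGroup E] [ContinuousConstSMul ℂ E] (T : E →L[ℂ] E) : Prop :=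
  ∃ P : E →L[ℂ] E, ∀ x, Filter.Tendsto (fun n => cesaroMean T n x) Filter.atTop (nhds (P x))

/-- `T` is hypercyclic: some orbit `{T^n x : n ≥ 0}` is dense. -/
def IsHypercyclic (T : E →L[ℂ] E) : Prop := ∃ x, Dense (range fun n : ℕ => (T ^ n) x)

/-- `T` is chaotic: it is hypercyclic and its periodic points are dense. -/
def IsChaotic (T : E →L[ℂ] E) : Prop :=
  IsHypercyclic T ∧ Dense {u : E | ∃ n : ℕ, 1 ≤ n ∧ (T ^ n) u = u}

/-- The point spectrum: all `λ` such that `λ I - T` is not injective. -/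
def pointSpectrum [IsTopologicalAddGroup E] [ContinuousConstSMul ℂ E] (T : E →L[ℂ] E) : Set ℂ :=
  {μ | ¬ Function.Injective (μ • ContinuousLinearMap.id ℂ E - T)}

end Dynamics

section Dynamics

open Filter Topology

variable {E : Type*} [AddCommGroup E] [Module ℂ E]

/-- The iterates of `T` act on an eigenvector through the powers of the eigenvalue. -/
theorem ContinuousLinearMap.pow_apply_of_eigen [TopologicalSpace E] {T : E →L[ℂ] E} {μ : ℂ} {x : E}
    (h : T x = μ • x) (n : ℕ) : (T ^ n) x = μ ^ n • x := by
  induction n with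
  | zero => simp
  | succ n ih => rw [pow_succ', mul_apply_eq_comp, ih, map_smul, h, smul_smul, pow_succ]

/-- **Birkhoff's transitivity theorem**. -/
theorem isHypercyclic_of_transitive [TopologicalSpace E] [BaireSpace E]
    [SecondCountableTopology E] (T : E →L[ℂ] E)
    (hT : ∀ U V : Set E, IsOpen U → IsOpen V → U.Nonempty → V.Nonempty →
      ∃ n : ℕ, ∃ x ∈ U, (T ^ n) x ∈ V) : IsHypercyclic T := by
  set B := TopologicalSpace.countableBasis E
  have hBc : B.Countable := TopologicalSpace.countable_countableBasis E
  have hB := TopologicalSpace.isBasis_countableBasis E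
  have hd : Dense (⋂ V ∈ B, ⋃ n : ℕ, (fun x => (T ^ n) x) ⁻¹' V) := by
    refine dense_biInter_of_isOpen (fun V hV => isOpen_iUnion fun n =>
      (hB.isOpen hV).preimage (T ^ n).continuous) hBc fun V hV => ?_
    refine dense_iff_inter_open.2 fun U hU hU' => ?_
    obtain ⟨n, x, hx, hx'⟩ := hT U V hU (hB.isOpen hV) hU'
      (TopologicalSpace.nonempty_of_mem_countableBasis hV)
    exact ⟨x, hx, mem_iUnion.2 ⟨n, hx'⟩⟩
  obtain ⟨x, hx⟩ := hd.nonempty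
  refine ⟨x, hB.dense_iff.2 fun V hV _ => ?_⟩
  obtain ⟨n, hn⟩ := mem_iUnion.1 (mem_iInter₂.1 hx V hV)
  exact ⟨_, hn, mem_range_self n⟩

/-- **The Godefroy–Shapiro criterion**. -/
theorem isHypercyclic_of_dense_eigen [TopologicalSpace E] [IsTopologicalAddGroup E]
    [ContinuousSMul ℂ E] [BaireSpace E] [SecondCountableTopology E] (T : E →L[ℂ] E)
    (h0 : Dense (Submodule.span ℂ {x : E | ∃ μ : ℂ, ‖μ‖ < 1 ∧ T x = μ • x} : Set E))
    (h1 : Dense (Submodule.span ℂ {x : E | ∃ μ : ℂ, 1 < ‖μ‖ ∧ T x = μ • x} : Set E)) :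
    IsHypercyclic T := by
  refine isHypercyclic_of_transitive T fun U V hU hV hU' hV' => ?_
  obtain ⟨u, huU, hu⟩ := h0.inter_open_nonempty U hU hU'
  obtain ⟨v, hvV, hv⟩ := h1.inter_open_nonempty V hV hV'
  have hTu : Tendsto (fun n => (T ^ n) u) atTop (𝓝 0) := by
    clear huU
    induction hu using Submodule.span_induction with
    | mem x hx =>
      obtain ⟨μ, hμ, hx⟩ := hx
      simp_rw [ContinuousLinearMap.pow_apply_of_eigen hx]
      simpa using (tendsto_pow_atTop_nhds_zero_of_norm_lt_one hμ).smul_const x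
    | zero => simpa using tendsto_const_nhds
    | add x y _ _ hx hy => simpa using hx.add hy
    | smul a x _ hx => simpa using hx.const_smul a
  have hTv : ∃ w : ℕ → E, Tendsto w atTop (𝓝 0) ∧ ∀ n, (T ^ n) (w n) = v := by
    clear hvV
    induction hv using Submodule.span_induction with
    | mem x hx =>
      obtain ⟨μ, hμ, hx⟩ := hx
      have hμ0 : μ ≠ 0 := fun h => by simp [h] at hμ; linarith
      refine ⟨fun n => (μ⁻¹) ^ n • x, ?_, fun n => ?_⟩
      · have : ‖μ⁻¹‖ < 1 := by rw [norm_inv]; exact inv_lt_one_of_one_lt₀ hμ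
        simpa using (tendsto_pow_atTop_nhds_zero_of_norm_lt_one this).smul_const x
      · rw [map_smul, ContinuousLinearMap.pow_apply_of_eigen hx, smul_smul, ← mul_pow,
          inv_mul_cancel₀ hμ0, one_pow, one_smul]
    | zero => exact ⟨fun _ => 0, tendsto_const_nhds, by simp⟩
    | add x y _ _ hx hy =>
      obtain ⟨w, hw, hw'⟩ := hx
      obtain ⟨z, hz, hz'⟩ := hy
      exact ⟨fun n => w n + z n, by simpa using hw.add hz, fun n => by rw [map_add, hw', hz']⟩
    | smul a x _ hx =>
      obtain ⟨w, hw, hw'⟩ := hx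
      exact ⟨fun n => a • w n, by simpa using hw.const_smul a, fun n => by rw [map_smul, hw']⟩
  obtain ⟨w, hw, hw'⟩ := hTv
  have e1 : ∀ᶠ n in atTop, u + w n ∈ U := by
    have : Tendsto (fun n => u + w n) atTop (𝓝 u) := by simpa using hw.const_add u
    exact this.eventually (hU.mem_nhds huU)
  have e2 : ∀ᶠ n in atTop, (T ^ n) u + v ∈ V := by
    have : Tendsto (fun n => (T ^ n) u + v) atTop (𝓝 v) := by simpa using hTu.add_const v
    exact this.eventually (hV.mem_nhds hvV)
  obtain ⟨n, hn1, hn2⟩ := (e1.and e2).exists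
  exact ⟨n, u + w n, hn1, by rwa [map_add, hw']⟩

/-- The periodic points of a linear operator are dense as soon as they span a dense subspace. -/
theorem dense_periodic_of_dense_span [TopologicalSpace E] (T : E →L[ℂ] E)
    (h : Dense (Submodule.span ℂ {u : E | ∃ n : ℕ, 1 ≤ n ∧ (T ^ n) u = u} : Set E)) :
    Dense {u : E | ∃ n : ℕ, 1 ≤ n ∧ (T ^ n) u = u} := by
  have iter : ∀ {n : ℕ} {u : E}, (T ^ n) u = u → ∀ m : ℕ, (T ^ (n * m)) u = u := by
    intro n u hu m
    rw [pow_mul]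
    have hu' : (T ^ n) u = (1 : ℂ) • u := by rw [hu, one_smul]
    rw [ContinuousLinearMap.pow_apply_of_eigen hu', one_pow, one_smul]
  refine h.mono fun x hx => ?_
  induction hx using Submodule.span_induction with
  | mem x hx => exact hx
  | zero => exact ⟨1, le_rfl, map_zero _⟩
  | add x y _ _ hx hy =>
    obtain ⟨n, hn, hx⟩ := hx
    obtain ⟨m, hm, hy⟩ := hy
    refine ⟨n * m, one_le_mul hn hm, ?_⟩
    rw [map_add, iter hx, mul_comm, iter hy]
  | smul a x _ hx =>
    obtain ⟨n, hn, hx⟩ := hx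
    exact ⟨n, hn, by rw [map_smul, hx]⟩

/-- An operator with an eigenvalue outside the closed unit disc is not power bounded. -/
theorem not_isPowerBounded_of_eigen [UniformSpace E] [IsUniformAddGroup E] [ContinuousSMul ℂ E]
    {T : E →L[ℂ] E} {μ : ℂ} {x : E} (h : T x = μ • x) (hμ : 1 < ‖μ‖) {s : Seminorm ℂ E}
    (hs : Continuous s) (hx : s x ≠ 0) : ¬ IsPowerBounded T := by
  intro hT
  have hU : {y : E × E | s (y.2 - y.1) < 1} ∈ uniformity E := by
    rw [uniformity_eq_comap_nhds_zero]
    refine ⟨{y | s y < 1}, (isOpen_lt hs continuous_const).mem_nhds (by simp), fun y hy => hy⟩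
  have h0 := hT 0 _ hU
  have hlim : Tendsto (fun t : ℝ => (t : ℂ) • x) (𝓝[≠] 0) (𝓝 0) := by
    have : Continuous fun t : ℝ => (t : ℂ) • x := by fun_prop
    simpa using (this.tendsto 0).mono_left nhdsWithin_le_nhds
  obtain ⟨t, ht, ht0⟩ := ((hlim.eventually h0).and self_mem_nhdsWithin).exists
  have hpos : 0 < |t| * s x :=
    mul_pos (abs_pos.2 ht0) ((apply_nonneg s x).lt_of_ne' hx)
  obtain ⟨n, hn⟩ := pow_unbounded_of_one_lt (|t| * s x)⁻¹ hμ
  have h1 : s ((T ^ (n + 1)) ((t : ℂ) • x) - (T ^ (n + 1)) 0) < 1 := ht n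
  rw [map_zero, sub_zero, map_smul, ContinuousLinearMap.pow_apply_of_eigen h, map_smul_eq_mul,
    map_smul_eq_mul, norm_pow, Complex.norm_real, Real.norm_eq_abs, mul_left_comm] at h1
  have h2 : ‖μ‖ ^ n ≤ ‖μ‖ ^ (n + 1) := pow_le_pow_right₀ hμ.le n.le_succ
  have h3 : 1 < ‖μ‖ ^ (n + 1) * (|t| * s x) := by
    rw [← inv_lt_iff_one_lt_mul₀ hpos]
    exact hn.trans_le h2
  linarith

/-- An operator with an eigenvalue in `(1, ∞)` is not mean ergodic. -/
theorem not_isMeanErgodic_of_eigen [TopologicalSpace E] [IsTopologicalAddGroup E]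
    [ContinuousSMul ℂ E] {T : E →L[ℂ] E} {μ : ℝ} {x : E} (h : T x = (μ : ℂ) • x) (hμ : 1 < μ)
    {s : Seminorm ℂ E} (hs : Continuous s) (hx : s x ≠ 0) : ¬ IsMeanErgodic T := by
  rintro ⟨P, hP⟩
  have hlim := (hs.tendsto _).comp (hP x)
  have hpos : 0 < s x := (apply_nonneg s x).lt_of_ne' hx
  have hle : ∀ᶠ n : ℕ in atTop, μ ^ n / n * s x ≤ (s ∘ fun n => cesaroMean T n x) n := by
    filter_upwards [eventually_ge_atTop 1] with n hn
    have e : cesaroMean T n x = ((1 / (n : ℝ) * ∑ m ∈ Finset.Icc 1 n, μ ^ m : ℝ) : ℂ) • x := by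
      simp only [cesaroMean, smul_apply, sum_apply,
        ContinuousLinearMap.pow_apply_of_eigen h]
      rw [← Finset.sum_smul, smul_smul]
      push_cast
      rfl
    have hμ0 : 0 < μ := one_pos.trans hμ
    have hsum : 0 ≤ ∑ m ∈ Finset.Icc 1 n, μ ^ m := Finset.sum_nonneg fun m _ => by positivity
    rw [Function.comp_apply, e, map_smul_eq_mul, Complex.norm_real, Real.norm_of_nonneg
      (by positivity), div_eq_inv_mul, one_div]
    gcongr
    exact Finset.single_le_sum (f := fun m => μ ^ m) (fun m _ => by positivity)
      (Finset.mem_Icc.2 ⟨hn, le_rfl⟩)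
  have htop : Tendsto (fun n : ℕ => μ ^ n / n * s x) atTop atTop := by
    refine Tendsto.atTop_mul_const hpos ?_
    have h0 := tendsto_pow_const_div_const_pow_of_one_lt 1 hμ
    have h1 : Tendsto (fun n : ℕ => (n : ℝ) ^ 1 / μ ^ n) atTop (𝓝[>] 0) := by
      refine tendsto_nhdsWithin_iff.2 ⟨h0, ?_⟩
      filter_upwards [eventually_ge_atTop 1] with n hn
      have : (0 : ℝ) < n := by exact_mod_cast hn
      have : 0 < μ := one_pos.trans hμ
      simp only [mem_Ioi]
      positivity
    refine h1.inv_tendsto_nhdsGT_zero.congr fun n => ?_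
    simp
  exact not_tendsto_nhds_of_tendsto_atTop (tendsto_atTop_mono' _ hle htop) _ hlim

end Dynamics

namespace LpLoc

open Filter Topology

variable {p : ℝ}

instance factOneLeOfReal [Fact (1 < p)] : Fact (1 ≤ ENNReal.ofReal p) := ⟨one_le_ofReal⟩

theorem Ici_zero_eq_iUnion : Ici (0 : ℝ) = ⋃ j : ℕ, Icc (0 : ℝ) j := by
  ext x
  simp only [mem_Ici, mem_iUnion, mem_Icc]
  exact ⟨fun hx => (exists_nat_ge x).imp fun j hj => ⟨hx, hj⟩, fun ⟨_, hx⟩ => hx.1⟩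

theorem ae_halfLine_pos : ∀ᵐ x ∂halfLineMeasure, 0 < x := by
  change ∀ᵐ x ∂volume.restrict (Ici (0 : ℝ)), 0 < x
  rw [← restrict_Ioi_eq_restrict_Ici]
  exact ae_restrict_mem measurableSet_Ioi

/-- The class of a function that is `p`-integrable on all the intervals `[0, j]`. -/
noncomputable def ofMemLp (f : ℝ → ℂ)
    (hf : ∀ j : ℕ, MemLp f (ENNReal.ofReal p) (volume.restrict (Icc (0 : ℝ) j))) : LpLoc p :=
  have hm : AEStronglyMeasurable f halfLineMeasure := by
    change AEStronglyMeasurable f (volume.restrict (Ici (0 : ℝ)))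
    rw [Ici_zero_eq_iUnion, aestronglyMeasurable_iUnion_iff]
    exact fun j => (hf j).1
  ⟨AEEqFun.mk f hm, fun j => (memLp_congr_ae (coeFn_ae_Icc (AEEqFun.coeFn_mk _ _) j)).2 (hf j)⟩

theorem coeFn_ofMemLp (f : ℝ → ℂ)
    (hf : ∀ j : ℕ, MemLp f (ENNReal.ofReal p) (volume.restrict (Icc (0 : ℝ) j))) :
    ofMemLp f hf =ᵐ[halfLineMeasure] f :=
  AEEqFun.coeFn_mk _ _

/-- The restriction of an element of `LpLoc p` to `[0, j]`. -/
noncomputable def restr (p : ℝ) [Fact (1 < p)] (j : ℕ) :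
    LpLoc p →ₗ[ℂ] Lp ℂ (ENNReal.ofReal p) (volume.restrict (Icc (0 : ℝ) j)) where
  toFun f := (f.memLp j).toLp
  map_add' f g := by
    rw [← MemLp.toLp_add]
    exact MemLp.toLp_congr _ _ (coeFn_ae_Icc (coeFn_add f g) j)
  map_smul' c f := by
    rw [RingHom.id_apply, ← MemLp.toLp_const_smul]
    exact MemLp.toLp_congr _ _ (coeFn_ae_Icc (coeFn_smul c f) j)

theorem coeFn_restr [Fact (1 < p)] (j : ℕ) (f : LpLoc p) :
    restr p j f =ᵐ[volume.restrict (Icc (0 : ℝ) j)] f := (f.memLp j).coeFn_toLp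

theorem norm_restr [Fact (1 < p)] (j : ℕ) (f : LpLoc p) : ‖restr p j f‖ = seminorm p j f :=
  Lp.norm_toLp _ (f.memLp j)

theorem seminorm_apply [Fact (1 < p)] (j : ℕ) (f : LpLoc p) : seminorm p j f =
    (eLpNorm f (ENNReal.ofReal p) (volume.restrict (Icc (0 : ℝ) j))).toReal := rfl

theorem seminorm_mono [Fact (1 < p)] : Monotone (seminorm p) := fun i j hij f =>
  ENNReal.toReal_mono (f.memLp j).2.ne (eLpNorm_mono_measure _
    (Measure.restrict_mono (Icc_subset_Icc_right (by exact_mod_cast hij)) le_rfl))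

theorem seminorm_le_of_ae [Fact (1 < p)] {f g : LpLoc p}
    (h : ∀ᵐ x ∂halfLineMeasure, ‖f x‖ ≤ ‖g x‖) (j : ℕ) : seminorm p j f ≤ seminorm p j g :=
  ENNReal.toReal_mono (g.memLp j).2.ne
    (eLpNorm_mono_ae (ae_mono (restrict_Icc_le_halfLine j) h))

theorem finset_sup_seminorm_le [Fact (1 < p)] (s : Finset ℕ) :
    ∃ j, s.sup (seminorm p) ≤ seminorm p j :=
  ⟨s.sup id, Finset.sup_le fun _ hi => seminorm_mono (Finset.le_sup (f := id) hi)⟩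

theorem continuous_seminorm [Fact (1 < p)] (j : ℕ) : Continuous (seminorm p j) :=
  withSeminorms.continuous_seminorm j

theorem continuous_restr [Fact (1 < p)] (j : ℕ) : Continuous (restr p j) := by
  refine continuous_of_continuousAt_zero (restr p j) ?_
  rw [ContinuousAt, map_zero, tendsto_zero_iff_norm_tendsto_zero]
  simp_rw [norm_restr]
  simpa using (continuous_seminorm (p := p) j).tendsto 0

theorem ext_of_restr [Fact (1 < p)] {f g : LpLoc p} (h : ∀ j, restr p j f = restr p j g) :
    f = g := by
  apply ext
  change ∀ᵐ x ∂volume.restrict (Ici (0 : ℝ)), f x = g x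
  rw [Ici_zero_eq_iUnion, ae_restrict_iUnion_iff]
  exact fun j => ((coeFn_restr j f).symm.trans (by rw [h j])).trans (coeFn_restr j g)

theorem hasBasis_nhds [Fact (1 < p)] (f : LpLoc p) :
    (𝓝 f).HasBasis (fun x : ℕ × ℝ => 0 < x.2) fun x => (seminorm p x.1).ball f x.2 := by
  refine withSeminorms.hasBasis_ball.to_hasBasis (fun x hx => ?_) fun x hx =>
    ⟨({x.1}, x.2), hx, by rw [Finset.sup_singleton]⟩
  obtain ⟨j, hj⟩ := finset_sup_seminorm_le (p := p) x.1
  exact ⟨(j, x.2), hx, Seminorm.ball_antitone hj⟩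

theorem mem_closure_iff_seminorm [Fact (1 < p)] {f : LpLoc p} {S : Set (LpLoc p)} :
    f ∈ closure S ↔ ∀ (j : ℕ) (ε : ℝ), 0 < ε → ∃ g ∈ S, seminorm p j (g - f) < ε := by
  rw [mem_closure_iff_nhds_basis (hasBasis_nhds f)]
  simp [Seminorm.mem_ball]

theorem mem_closure_iff_restr [Fact (1 < p)] {f : LpLoc p} {S : Set (LpLoc p)} :
    f ∈ closure S ↔ ∀ j : ℕ, restr p j f ∈ closure (restr p j '' S) := by
  simp_rw [mem_closure_iff_seminorm, Metric.mem_closure_iff, exists_mem_image, dist_eq_norm',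
    ← map_sub, norm_restr]

/-- The restrictions to all the intervals `[0, j]`. -/
noncomputable def restrPi (p : ℝ) [Fact (1 < p)] (f : LpLoc p) :
    ∀ j : ℕ, Lp ℂ (ENNReal.ofReal p) (volume.restrict (Icc (0 : ℝ) j)) := fun j => restr p j f

theorem isInducing_restrPi [Fact (1 < p)] : IsInducing (restrPi p) := by
  refine isInducing_iff_nhds.2 fun f => le_antisymm
    ((continuous_pi fun j => continuous_restr j).continuousAt.tendsto.le_comap) ?_
  refine (hasBasis_nhds f).ge_iff.2 fun x hx => ?_
  refine ⟨(fun g => g x.1) ⁻¹' Metric.ball (restr p x.1 f) x.2,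
    (continuous_apply x.1).continuousAt.preimage_mem_nhds (Metric.ball_mem_nhds _ hx),
    fun g hg => ?_⟩
  rw [Seminorm.mem_ball, ← norm_restr, map_sub, ← dist_eq_norm]
  exact hg

/-- Functions given compatibly on all the intervals `[0, j]` come from an element of `LpLoc p`. -/
theorem exists_restr_eq [Fact (1 < p)]
    (g : ∀ j : ℕ, Lp ℂ (ENNReal.ofReal p) (volume.restrict (Icc (0 : ℝ) j)))
    (hg : ∀ i j : ℕ, i ≤ j → g j =ᵐ[volume.restrict (Icc (0 : ℝ) i)] g i) :
    ∃ f, restrPi p f = g := by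
  set F : ℝ → ℂ := fun x => g ⌈x⌉₊ x with hF
  have hFj : ∀ j : ℕ, F =ᵐ[volume.restrict (Icc (0 : ℝ) j)] g j := fun j => by
    have h1 : ∀ i : ℕ, i ≤ j → ∀ᵐ x, x ∈ Icc (0 : ℝ) i → g j x = g i x := fun i hi =>
      (ae_restrict_iff' measurableSet_Icc).1 (hg i j hi)
    have h2 : ∀ᵐ x, ∀ i : ℕ, i ≤ j → x ∈ Icc (0 : ℝ) i → g j x = g i x :=
      ae_all_iff.2 fun i => by
        by_cases hi : i ≤ j
        · filter_upwards [h1 i hi] with x hx _ using hx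
        · exact .of_forall fun x h => absurd h hi
    refine (ae_restrict_iff' measurableSet_Icc).2 ?_
    filter_upwards [h2] with x hx hxj
    exact (hx _ (Nat.ceil_le.2 hxj.2) ⟨hxj.1, Nat.le_ceil x⟩).symm
  have hmem : ∀ j : ℕ, MemLp F (ENNReal.ofReal p) (volume.restrict (Icc (0 : ℝ) j)) := fun j =>
    (memLp_congr_ae (hFj j)).2 (Lp.memLp (g j))
  refine ⟨ofMemLp F hmem, funext fun j => ?_⟩
  exact Lp.ext ((coeFn_restr j _).trans
    ((coeFn_ae_Icc (coeFn_ofMemLp F hmem) j).trans (hFj j)))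

theorem isClosedEmbedding_restrPi [Fact (1 < p)] : IsClosedEmbedding (restrPi p) := by
  refine ⟨⟨isInducing_restrPi, fun f g h => ext_of_restr fun j => congrFun h j⟩, ?_⟩
  refine isClosed_of_closure_subset fun g hg => exists_restr_eq g fun i j hij => ?_
  obtain ⟨u, hu, hlim⟩ := mem_closure_iff_seq_limit.1 hg
  choose f hf using hu
  have hle : volume.restrict (Icc (0 : ℝ) i) ≤ volume.restrict (Icc (0 : ℝ) j) :=
    Measure.restrict_mono (Icc_subset_Icc_right (by exact_mod_cast hij)) le_rfl
  have hconv : ∀ j, Tendsto (fun n => eLpNorm (⇑(f n) - ⇑(g j)) (ENNReal.ofReal p)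
      (volume.restrict (Icc (0 : ℝ) j))) atTop (𝓝 0) := fun j => by
    have := (Lp.tendsto_Lp_iff_tendsto_eLpNorm' _ _).1 ((tendsto_pi_nhds.1 hlim) j)
    refine this.congr fun n => eLpNorm_congr_ae ?_
    rw [← hf n]
    exact (coeFn_restr j (f n)).sub EventuallyEq.rfl
  have hj := tendsto_of_tendsto_of_tendsto_of_le_of_le tendsto_const_nhds (hconv j)
    (fun n => zero_le) fun n => eLpNorm_mono_measure _ hle
  have hsum := (hconv i).add hj
  have hle0 :
      eLpNorm (⇑(g j) - ⇑(g i)) (ENNReal.ofReal p) (volume.restrict (Icc (0 : ℝ) i)) ≤ 0 := by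
    rw [add_zero] at hsum
    refine ge_of_tendsto' hsum fun n => ?_
    have e : ⇑(g j) - ⇑(g i) = (⇑(f n) - ⇑(g i)) - (⇑(f n) - ⇑(g j)) := by abel
    rw [e]
    exact eLpNorm_sub_le (((f n).memLp i).1.sub (Lp.memLp (g i)).1)
      (((f n).memLp i).1.sub ((Lp.memLp (g j)).1.mono_measure hle)) one_le_ofReal
  have h0 := (eLpNorm_eq_zero_iff (((Lp.memLp (g j)).1.mono_measure hle).sub (Lp.memLp (g i)).1)
    (one_pos.trans_le one_le_ofReal).ne').1 (le_antisymm hle0 (zero_le))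
  exact sub_ae_eq_zero _ _ |>.1 h0

instance polishSpace [Fact (1 < p)] : PolishSpace (LpLoc p) := by
  have : Fact (ENNReal.ofReal p ≠ ∞) := ⟨ENNReal.ofReal_ne_top⟩
  exact isClosedEmbedding_restrPi.polishSpace

instance secondCountableTopology [Fact (1 < p)] : SecondCountableTopology (LpLoc p) :=
  inferInstance

instance t2Space [Fact (1 < p)] : T2Space (LpLoc p) := inferInstance

instance baireSpace [Fact (1 < p)] : BaireSpace (LpLoc p) := by
  let _ := TopologicalSpace.upgradeIsCompletelyMetrizable (LpLoc p)
  infer_instance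

theorem lintegral_rpow_Ioc {r : ℝ} (hr : -1 < r) {x : ℝ} (hx : 0 ≤ x) :
    ∫⁻ t in Ioc 0 x, ENNReal.ofReal (t ^ r) = ENNReal.ofReal (x ^ (r + 1) / (r + 1)) := by
  have hint := intervalIntegral.intervalIntegrable_rpow' (a := 0) (b := x) hr
  rw [intervalIntegrable_iff_integrableOn_Ioc_of_le hx] at hint
  rw [← ofReal_integral_eq_lintegral_ofReal hint
    ((ae_restrict_iff' measurableSet_Ioc).2 (.of_forall fun t ht => Real.rpow_nonneg ht.1.le _)),
    ← intervalIntegral.integral_of_le hx, integral_rpow (Or.inl hr),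
    Real.zero_rpow (by linarith), sub_zero]

theorem neg_one_lt_mul_re [hp : Fact (1 < p)] {a : ℂ} (ha : -(1 / p) < a.re) :
    -1 < p * a.re := by
  have hp0 : 0 < p := one_pos.trans hp.out
  have := mul_lt_mul_of_pos_left ha hp0
  rwa [mul_neg, mul_one_div_cancel hp0.ne'] at this

theorem eLpNorm_cpow [hp : Fact (1 < p)] {a : ℂ} (ha : -(1 / p) < a.re) (j : ℕ) :
    eLpNorm (fun x : ℝ => (x : ℂ) ^ a) (ENNReal.ofReal p) (volume.restrict (Icc (0 : ℝ) j)) =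
      ENNReal.ofReal (((j : ℝ) ^ (p * a.re + 1) / (p * a.re + 1)) ^ (1 / p)) := by
  have hp0 : 0 < p := one_pos.trans hp.out
  have hr := neg_one_lt_mul_re ha
  rw [eLpNorm_eq_lintegral_rpow_enorm_toReal (by simpa using hp0) ENNReal.ofReal_ne_top,
    ENNReal.toReal_ofReal hp0.le, restrict_Ioc_eq_restrict_Icc.symm,
    ← ENNReal.ofReal_rpow_of_nonneg (div_nonneg (by positivity) (by linarith)) (by positivity),
    ← lintegral_rpow_Ioc hr j.cast_nonneg]
  congr 1
  refine setLIntegral_congr_fun measurableSet_Ioc fun x hx => ?_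
  rw [← ofReal_norm, Complex.norm_cpow_eq_rpow_re_of_pos hx.1,
    ENNReal.ofReal_rpow_of_nonneg (Real.rpow_nonneg hx.1.le _) hp0.le, ← Real.rpow_mul hx.1.le,
    mul_comm p]

theorem memLp_cpow [Fact (1 < p)] {a : ℂ} (ha : -(1 / p) < a.re) (j : ℕ) :
    MemLp (fun x : ℝ => (x : ℂ) ^ a) (ENNReal.ofReal p) (volume.restrict (Icc (0 : ℝ) j)) :=
  ⟨(Complex.measurable_ofReal.pow_const a).aestronglyMeasurable, by
    rw [eLpNorm_cpow ha]; exact ENNReal.ofReal_lt_top⟩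

open Classical in
/-- The power function `x ↦ x ^ a` as an element of `LpLoc p`; zero unless `Re a > -1/p`. -/
noncomputable def power (p : ℝ) [Fact (1 < p)] (a : ℂ) : LpLoc p :=
  if ha : -(1 / p) < a.re then ofMemLp (fun x : ℝ => (x : ℂ) ^ a) (memLp_cpow ha) else 0

theorem coeFn_power [Fact (1 < p)] {a : ℂ} (ha : -(1 / p) < a.re) :
    power p a =ᵐ[halfLineMeasure] fun x : ℝ => (x : ℂ) ^ a := by
  rw [power, dif_pos ha]
  exact coeFn_ofMemLp _ _

theorem seminorm_power [Fact (1 < p)] {a : ℂ} (ha : -(1 / p) < a.re) (j : ℕ) :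
    seminorm p j (power p a) = ((j : ℝ) ^ (p * a.re + 1) / (p * a.re + 1)) ^ (1 / p) := by
  have hr := neg_one_lt_mul_re ha
  rw [seminorm_apply, eLpNorm_congr_ae (coeFn_ae_Icc (coeFn_power ha) j), eLpNorm_cpow ha,
    ENNReal.toReal_ofReal (Real.rpow_nonneg (div_nonneg (by positivity) (by linarith)) _)]

theorem seminorm_power_eq [hp : Fact (1 < p)] {a : ℂ} (ha : -(1 / p) < a.re) (j : ℕ) :
    seminorm p j (power p a) = (j : ℝ) ^ (a.re + 1 / p) * seminorm p 1 (power p a) := by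
  have hp0 : 0 < p := one_pos.trans hp.out
  have hr := neg_one_lt_mul_re ha
  rw [seminorm_power ha, seminorm_power ha, Nat.cast_one, Real.one_rpow, div_eq_mul_one_div,
    Real.mul_rpow (by positivity) (div_nonneg zero_le_one (by linarith)),
    ← Real.rpow_mul j.cast_nonneg]
  congr 2
  field_simp

theorem seminorm_one_power_pos [Fact (1 < p)] {a : ℂ} (ha : -(1 / p) < a.re) :
    0 < seminorm p 1 (power p a) := by
  have hr := neg_one_lt_mul_re ha
  rw [seminorm_power ha, Nat.cast_one, Real.one_rpow]
  exact Real.rpow_pos_of_pos (div_pos one_pos (by linarith)) _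

theorem add_one_ne_zero [hp : Fact (1 < p)] {a : ℂ} (ha : -(1 / p) < a.re) : a + 1 ≠ 0 := by
  have hp0 : 0 < p := one_pos.trans hp.out
  have h1 : 1 / p < 1 := (div_lt_one hp0).2 hp.out
  intro h
  have := congrArg Complex.re h
  simp only [Complex.add_re, Complex.one_re, Complex.zero_re] at this
  linarith

/-- The power functions are eigenvectors of the Cesàro operator. -/
theorem cesaro_power [hp : Fact (1 < p)] {a : ℂ} (ha : -(1 / p) < a.re) :
    cesaro p (power p a) = (a + 1)⁻¹ • power p a := by
  have hp0 : 0 < p := one_pos.trans hp.out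
  have h1 : 1 / p < 1 := (div_lt_one hp0).2 hp.out
  apply ext
  filter_upwards [coeFn_cesaroMap (power p a), coeFn_smul (a + 1)⁻¹ (power p a), coeFn_power ha,
    ae_halfLine_pos] with x h2 h3 h4 hx
  have hx0 : (x : ℂ) ≠ 0 := by exact_mod_cast hx.ne'
  change (power p a).cesaroMap x = _
  rw [h2, h3, h4, cesaroFun_congr (coeFn_power ha) hx.le, cesaroFun,
    integral_cpow (Or.inl (by linarith)), Complex.ofReal_zero,
    Complex.zero_cpow (add_one_ne_zero ha), sub_zero, Complex.cpow_add _ _ hx0, Complex.cpow_one]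
  field_simp

theorem norm_cpow_add_sub_le {a h : ℂ} {d : ℝ} (hd : 0 < d) (hh : ‖h‖ ≤ d) {x : ℝ} (hx : 0 < x) :
    ‖(x : ℂ) ^ (a + h) - (x : ℂ) ^ a - h * ((x : ℂ) ^ a * Real.log x)‖ ≤
      2 / d ^ 2 * ‖h‖ ^ 2 * (x ^ (a.re + 2 * d) + x ^ (a.re - 2 * d)) := by
  have hx0 : (x : ℂ) ≠ 0 := by exact_mod_cast hx.ne'
  set l := Real.log x
  have e1 : (x : ℂ) ^ (a + h) - (x : ℂ) ^ a - h * ((x : ℂ) ^ a * l) =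
      (x : ℂ) ^ a * (Complex.exp (l * h) - 1 - l * h) := by
    rw [Complex.cpow_add _ _ hx0, Complex.cpow_def_of_ne_zero hx0 h, ← Complex.ofReal_log hx.le]
    ring
  have e2 : ‖Complex.exp (l * h) - 1 - l * h‖ ≤ ‖(l : ℂ) * h‖ ^ 2 * Real.exp ‖(l : ℂ) * h‖ := by
    have := Complex.norm_exp_sub_sum_le_norm_mul_exp ((l : ℂ) * h) 2
    simpa [Finset.sum_range_succ, sub_sub] using this
  have e3 : ‖(l : ℂ) * h‖ = |l| * ‖h‖ := by rw [norm_mul, Complex.norm_real, Real.norm_eq_abs]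
  have e4 : (d * |l|) ^ 2 / 2 ≤ Real.exp (d * |l|) := by
    have := Real.pow_div_factorial_le_exp (d * |l|) (by positivity) 2
    simpa [Nat.factorial] using this
  have e5 : |l| ^ 2 ≤ 2 / d ^ 2 * Real.exp (d * |l|) := by
    rw [div_mul_eq_mul_div, le_div_iff₀ (by positivity)]
    linarith [mul_pow d |l| 2]
  have e6 : Real.exp (2 * d * |l|) ≤ x ^ (2 * d) + x ^ (-(2 * d)) := by
    rw [Real.rpow_def_of_pos hx, Real.rpow_def_of_pos hx]
    rcases abs_cases l with ⟨h1, _⟩ | ⟨h1, _⟩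
    · rw [h1, mul_comm]; exact le_add_of_nonneg_right (Real.exp_pos _).le
    · rw [h1]
      refine le_trans (le_of_eq ?_) (le_add_of_nonneg_left (Real.exp_pos _).le)
      congr 1
      change 2 * d * -l = l * -(2 * d)
      ring
  rw [e1, norm_mul, Complex.norm_cpow_eq_rpow_re_of_pos hx]
  rw [e3] at e2
  calc x ^ a.re * ‖Complex.exp (l * h) - 1 - l * h‖
      ≤ x ^ a.re * ((|l| * ‖h‖) ^ 2 * Real.exp (|l| * ‖h‖)) := by gcongr
    _ ≤ x ^ a.re * (2 / d ^ 2 * Real.exp (d * |l|) * ‖h‖ ^ 2 * Real.exp (|l| * d)) := by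
        rw [mul_pow]; gcongr
    _ = x ^ a.re * (2 / d ^ 2 * ‖h‖ ^ 2 * Real.exp (2 * d * |l|)) := by
        rw [show 2 * d * |l| = d * |l| + |l| * d by ring, Real.exp_add]; ring
    _ ≤ x ^ a.re * (2 / d ^ 2 * ‖h‖ ^ 2 * (x ^ (2 * d) + x ^ (-(2 * d)))) := by gcongr
    _ = _ := by rw [Real.rpow_add hx, sub_eq_add_neg, Real.rpow_add hx]; ring

theorem norm_cpow_mul_log_le {a : ℂ} {d : ℝ} (hd : 0 < d) {x : ℝ} (hx : 0 < x) :
    ‖(x : ℂ) ^ a * Real.log x‖ ≤ 1 / d * (x ^ (a.re + d) + x ^ (a.re - d)) := by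
  have e1 : |Real.log x| ≤ 1 / d * (x ^ d + x ^ (-d)) := by
    rw [Real.rpow_def_of_pos hx, Real.rpow_def_of_pos hx, one_div_mul_eq_div, le_div_iff₀ hd]
    have h1 := Real.add_one_le_exp (Real.log x * d)
    have h2 := Real.add_one_le_exp (Real.log x * -d)
    have h3 := Real.exp_pos (Real.log x * d)
    have h4 := Real.exp_pos (Real.log x * -d)
    rcases abs_cases (Real.log x) with ⟨h, _⟩ | ⟨h, _⟩ <;> rw [h] <;> nlinarith
  rw [norm_mul, Complex.norm_cpow_eq_rpow_re_of_pos hx, Complex.norm_real, Real.norm_eq_abs,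
    Real.rpow_add hx, sub_eq_add_neg, Real.rpow_add hx]
  calc x ^ a.re * |Real.log x| ≤ x ^ a.re * (1 / d * (x ^ d + x ^ (-d))) := by gcongr
    _ = _ := by ring

theorem norm_power_ofReal_add [Fact (1 < p)] {r s c : ℝ} (hr : -(1 / p) < r) (hs : -(1 / p) < s)
    (hc : 0 ≤ c) : ∀ᵐ x ∂halfLineMeasure,
      ‖((c : ℂ) • (power p (r : ℂ) + power p (s : ℂ))) x‖ = c * (x ^ r + x ^ s) := by
  filter_upwards [ae_halfLine_pos, coeFn_power (p := p) (a := (r : ℂ)) hr,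
    coeFn_power (p := p) (a := (s : ℂ)) hs, coeFn_smul (c : ℂ) (power p (r : ℂ) + power p (s : ℂ)),
    coeFn_add (power p (r : ℂ)) (power p (s : ℂ))] with x hx h1 h2 h3 h4
  rw [h3, h4, h1, h2, ← Complex.ofReal_cpow hx.le, ← Complex.ofReal_cpow hx.le,
    ← Complex.ofReal_add, ← Complex.ofReal_mul, Complex.norm_real, Real.norm_of_nonneg]
  positivity

/-- The powers `x ^ a` depend holomorphically on `a`. -/
theorem differentiableAt_restr_power [Fact (1 < p)] {a : ℂ} (ha : -(1 / p) < a.re) (j : ℕ) :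
    DifferentiableAt ℂ (fun z => restr p j (power p z)) a := by
  obtain ⟨d, hd, had⟩ : ∃ d : ℝ, 0 < d ∧ -(1 / p) < a.re - 2 * d :=
    ⟨(a.re + 1 / p) / 4, by linarith, by linarith⟩
  have hlog : ∀ j : ℕ, MemLp (fun x : ℝ => (x : ℂ) ^ a * Real.log x) (ENNReal.ofReal p)
      (volume.restrict (Icc (0 : ℝ) j)) := fun j => by
    refine (memLp ((↑(1 / d) : ℂ) • (power p (a.re + d : ℝ) + power p (a.re - d : ℝ))) j).mono
      (((Complex.measurable_ofReal.pow_const a).mul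
        (Complex.measurable_ofReal.comp Real.measurable_log)).aestronglyMeasurable) ?_
    refine ae_mono (restrict_Icc_le_halfLine j) ?_
    filter_upwards [ae_halfLine_pos, norm_power_ofReal_add (p := p) (r := a.re + d)
      (s := a.re - d) (by linarith) (by linarith) (c := 1 / d) (by positivity)] with x hx h
    rw [h]
    exact norm_cpow_mul_log_le hd hx
  set D : LpLoc p := ofMemLp _ hlog with hD
  have hle : ∀ h : ℂ, ‖h‖ ≤ d →
      ‖restr p j (power p (a + h)) - restr p j (power p a) - h • restr p j D‖ ≤
        (2 / d ^ 2 * seminorm p j (power p (a.re + 2 * d : ℝ) + power p (a.re - 2 * d : ℝ))) *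
          ‖h ^ 2‖ := fun h hh => by
    have hah : -(1 / p) < (a + h).re := by
      have := (abs_le.1 ((Complex.abs_re_le_norm h).trans hh)).1
      rw [Complex.add_re]
      linarith
    rw [← map_sub, ← map_smul, ← map_sub, norm_restr]
    refine (seminorm_le_of_ae (g := ((2 / d ^ 2 * ‖h‖ ^ 2 : ℝ) : ℂ) •
      (power p (a.re + 2 * d : ℝ) + power p (a.re - 2 * d : ℝ))) ?_ j).trans (le_of_eq ?_)
    · have e : power p (a + h) - power p a - h • D =
          power p (a + h) + ((-1 : ℂ) • power p a + (-h) • D) := by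
        rw [neg_smul, neg_smul, one_smul]; abel
      rw [e]
      filter_upwards [ae_halfLine_pos, norm_power_ofReal_add (p := p) (r := a.re + 2 * d)
        (s := a.re - 2 * d) (by linarith) (by linarith) (c := 2 / d ^ 2 * ‖h‖ ^ 2) (by positivity),
        coeFn_power hah, coeFn_power ha, coeFn_ofMemLp _ hlog,
        coeFn_add (power p (a + h)) ((-1 : ℂ) • power p a + (-h) • D),
        coeFn_add ((-1 : ℂ) • power p a) ((-h) • D), coeFn_smul (-1) (power p a),
        coeFn_smul (-h) D] with x hx h1 h2 h3 h4 h5 h6 h7 h8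
      rw [h1, h5, h6, h7, h8, h2, h3, hD, h4]
      refine le_trans (le_of_eq (congrArg _ ?_)) (norm_cpow_add_sub_le hd hh hx)
      ring
    · rw [map_smul_eq_mul, Complex.norm_real, Real.norm_of_nonneg (by positivity), norm_pow]
      ring
  refine HasDerivAt.differentiableAt (f' := restr p j D) ?_
  rw [hasDerivAt_iff_isLittleO_nhds_zero]
  refine Asymptotics.IsBigO.trans_isLittleO (g := fun h : ℂ => h ^ 2) ?_ ?_
  · refine Asymptotics.IsBigO.of_bound (2 / d ^ 2 *
      seminorm p j (power p (a.re + 2 * d : ℝ) + power p (a.re - 2 * d : ℝ))) ?_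
    filter_upwards [Metric.closedBall_mem_nhds (0 : ℂ) hd] with h hh
    exact hle h (by simpa using hh)
  · simpa using Asymptotics.isLittleO_pow_pow (𝕜 := ℂ) (m := 1) (n := 2) (by norm_num)

/-- A closed subspace containing `x ^ a` for sufficiently many `a` contains all powers. -/
theorem power_mem_closure_span [hp : Fact (1 < p)] {A : Set ℂ} {z₀ : ℂ} (hz₀ : -(1 / p) < z₀.re)
    (hA : ∃ᶠ z in 𝓝[≠] z₀, z ∈ A) {a : ℂ} (ha : -(1 / p) < a.re) :
    power p a ∈ closure (Submodule.span ℂ (power p '' A) : Set (LpLoc p)) := by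
  rw [mem_closure_iff_restr]
  intro j
  set N := ((Submodule.span ℂ (power p '' A)).map (restr p j)).topologicalClosure with hN
  have : IsClosed (N : Set (Lp ℂ (ENNReal.ofReal p) (volume.restrict (Icc (0 : ℝ) j)))) :=
    Submodule.isClosed_topologicalClosure _
  have hU : IsOpen {z : ℂ | -(1 / p) < z.re} := isOpen_lt continuous_const Complex.continuous_re
  have han : AnalyticOnNhd ℂ (fun z => N.mkQL (restr p j (power p z))) {z | -(1 / p) < z.re} := by
    refine DifferentiableOn.analyticOnNhd (fun z hz => ?_) hU
    exact (N.mkQL.differentiableAt.comp z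
      (differentiableAt_restr_power hz j)).differentiableWithinAt
  have h0 := han.eqOn_zero_of_preconnected_of_frequently_eq_zero
    (convex_halfSpace_re_gt _).isPreconnected hz₀ (hA.mono fun z hz => ?_)
  · exact (Submodule.Quotient.mk_eq_zero N).1 (h0 ha)
  · refine (Submodule.Quotient.mk_eq_zero N).2 (Submodule.le_topologicalClosure _ ?_)
    exact Submodule.mem_map_of_mem (Submodule.subset_span (mem_image_of_mem _ hz))

theorem exists_polynomial_norm_sub_le {g : ℝ → ℂ} (hg : Continuous g) (b : ℝ) {ε : ℝ}
    (hε : 0 < ε) : ∃ P : Polynomial ℂ, ∀ x ∈ Icc 0 b, ‖P.eval (x : ℂ) - g x‖ ≤ ε := by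
  obtain ⟨P, hP⟩ := exists_polynomial_near_of_continuousOn 0 b (fun x => (g x).re)
    (by fun_prop) (ε / 2) (by positivity)
  obtain ⟨Q, hQ⟩ := exists_polynomial_near_of_continuousOn 0 b (fun x => (g x).im)
    (by fun_prop) (ε / 2) (by positivity)
  refine ⟨P.map (algebraMap ℝ ℂ) + Polynomial.C Complex.I * Q.map (algebraMap ℝ ℂ),
    fun x hx => ?_⟩
  have e : ∀ R : Polynomial ℝ, (R.map (algebraMap ℝ ℂ)).eval (x : ℂ) = ((R.eval x : ℝ) : ℂ) :=
    fun R => Polynomial.eval_map_apply (algebraMap ℝ ℂ) x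
  rw [Polynomial.eval_add, Polynomial.eval_mul, Polynomial.eval_C, e, e]
  refine (Complex.norm_le_abs_re_add_abs_im _).trans ?_
  have h1 := (hP x hx).le
  have h2 := (hQ x hx).le
  simp only [Complex.sub_re, Complex.add_re, Complex.ofReal_re, Complex.mul_re, Complex.I_re,
    Complex.I_im, Complex.ofReal_im, Complex.sub_im, Complex.add_im, Complex.mul_im]
  simp only [zero_mul, one_mul, mul_zero, add_zero, zero_add, sub_self]
  linarith

theorem exists_mem_span_natPower [hp : Fact (1 < p)] (P : Polynomial ℂ) :
    ∃ u ∈ Submodule.span ℂ (range fun n : ℕ => power p (n : ℂ)),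
      u =ᵐ[halfLineMeasure] fun x : ℝ => P.eval (x : ℂ) := by
  have hp0 : 0 < p := one_pos.trans hp.out
  induction P using Polynomial.induction_on' with
  | add P Q hP hQ =>
    obtain ⟨u, hu, hu'⟩ := hP
    obtain ⟨v, hv, hv'⟩ := hQ
    refine ⟨u + v, Submodule.add_mem _ hu hv, ?_⟩
    filter_upwards [hu', hv', coeFn_add u v] with x h1 h2 h3
    rw [h3, h1, h2, Polynomial.eval_add]
  | monomial n c =>
    refine ⟨c • power p (n : ℂ),
      Submodule.smul_mem _ _ (Submodule.subset_span (mem_range_self n)), ?_⟩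
    have hn : -(1 / p) < (n : ℂ).re := by
      rw [Complex.natCast_re]
      have : 0 < 1 / p := by positivity
      have : (0 : ℝ) ≤ n := n.cast_nonneg
      linarith
    filter_upwards [coeFn_smul c (power p (n : ℂ)), coeFn_power hn] with x h1 h2
    rw [h1, h2, Polynomial.eval_monomial, Complex.cpow_natCast]

/-- The polynomials are dense in `LpLoc p`. -/
theorem dense_span_natPower [hp : Fact (1 < p)] :
    Dense (Submodule.span ℂ (range fun n : ℕ => power p (n : ℂ)) : Set (LpLoc p)) := by
  have hp0 : 0 < p := one_pos.trans hp.out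
  intro f
  rw [mem_closure_iff_seminorm]
  intro j ε hε
  obtain ⟨g, -, hg, hgc, hgm⟩ := (f.memLp j).exists_hasCompactSupport_eLpNorm_sub_le
    ENNReal.ofReal_ne_top (ε := ENNReal.ofReal (ε / 2)) (by simpa using hε)
  have hJ : 0 < ((j : ℝ) + 1) ^ (1 / p) := by positivity
  obtain ⟨P, hP⟩ := exists_polynomial_norm_sub_le hgc j
    (ε := ε / 4 / ((j : ℝ) + 1) ^ (1 / p)) (by positivity)
  obtain ⟨u, hu, hu'⟩ := exists_mem_span_natPower (p := p) P
  refine ⟨u, hu, ?_⟩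
  have h1 : eLpNorm (⇑u - g) (ENNReal.ofReal p) (volume.restrict (Icc (0 : ℝ) j)) ≤
      ENNReal.ofReal (ε / 4) := by
    refine (eLpNorm_le_of_ae_bound (C := ε / 4 / ((j : ℝ) + 1) ^ (1 / p)) ?_).trans ?_
    · filter_upwards [coeFn_ae_Icc hu' j, ae_restrict_mem measurableSet_Icc] with x h1 hx
      rw [Pi.sub_apply, h1]
      exact hP x hx
    · rw [Measure.restrict_apply_univ, Real.volume_Icc, ENNReal.toReal_ofReal hp0.le, sub_zero,
        ENNReal.ofReal_rpow_of_nonneg j.cast_nonneg (by positivity),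
        ← ENNReal.ofReal_mul (by positivity)]
      refine ENNReal.ofReal_le_ofReal ?_
      rw [mul_div_left_comm]
      refine mul_le_of_le_one_right (by positivity) ((div_le_one hJ).2 ?_)
      rw [one_div]
      exact Real.rpow_le_rpow j.cast_nonneg (by linarith) (by positivity)
  have h2 : eLpNorm ⇑(u - f) (ENNReal.ofReal p) (volume.restrict (Icc (0 : ℝ) j)) ≤
      ENNReal.ofReal (ε / 4) + ENNReal.ofReal (ε / 2) := by
    have e : ⇑(u - f) =ᵐ[volume.restrict (Icc (0 : ℝ) j)] (⇑u - g) - (⇑f - g) := by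
      have h3 := coeFn_ae_Icc (coeFn_add u ((-1 : ℂ) • f)) j
      have h4 := coeFn_ae_Icc (coeFn_smul (-1) f) j
      rw [neg_one_smul, ← sub_eq_add_neg] at h3
      rw [neg_one_smul] at h4
      filter_upwards [h3, h4] with x h5 h6
      rw [h5, h6]
      simp only [Pi.sub_apply]
      ring
    rw [eLpNorm_congr_ae e]
    exact (eLpNorm_sub_le ((u.memLp j).1.sub hgm.1) ((f.memLp j).1.sub hgm.1) one_le_ofReal).trans
      (add_le_add h1 hg)
  rw [seminorm_apply]
  rw [← ENNReal.ofReal_add (by positivity) (by positivity)] at h2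
  have h3 := ENNReal.toReal_mono ENNReal.ofReal_ne_top h2
  rw [ENNReal.toReal_ofReal (by positivity)] at h3
  linarith

/-- Powers `x ^ a`, with `a` in a set having an accumulation point in the half plane
`Re a > -1/p`, span a dense subspace. -/
theorem dense_span_power [hp : Fact (1 < p)] {A : Set ℂ} {z₀ : ℂ} (hz₀ : -(1 / p) < z₀.re)
    (hA : ∃ᶠ z in 𝓝[≠] z₀, z ∈ A) :
    Dense (Submodule.span ℂ (power p '' A) : Set (LpLoc p)) := by
  have hp0 : 0 < p := one_pos.trans hp.out
  set N := (Submodule.span ℂ (power p '' A)).topologicalClosure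
  have hle : Submodule.span ℂ (range fun n : ℕ => power p (n : ℂ)) ≤ N := by
    rw [Submodule.span_le]
    rintro _ ⟨n, rfl⟩
    refine power_mem_closure_span hz₀ hA ?_
    rw [Complex.natCast_re]
    have : 0 < 1 / p := by positivity
    have : (0 : ℝ) ≤ n := n.cast_nonneg
    linarith
  have := (dense_span_natPower (p := p)).mono hle
  rw [dense_iff_closure_eq, (Submodule.isClosed_topologicalClosure _).closure_eq] at this
  exact dense_iff_closure_eq.2 this

theorem setLIntegral_comp_mul_le {H : ℝ → ℝ≥0∞} (hH : Measurable H) {s : ℝ} (hs : s ∈ Ioc (0 : ℝ) 1)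
    (b : ℝ) :
    ∫⁻ x in Ioc 0 b, H (s * x) ≤ ENNReal.ofReal s⁻¹ * ∫⁻ x in Ioc 0 b, H x := by
  have hsub : ∀ x ∈ Ioc 0 b, H (s * x) ≤ (Ioc 0 b).indicator H (s * x) := fun x hx => by
    rw [indicator_of_mem]
    exact ⟨mul_pos hs.1 hx.1, (mul_le_of_le_one_left hx.1.le hs.2).trans hx.2⟩
  calc ∫⁻ x in Ioc 0 b, H (s * x) ≤ ∫⁻ x in Ioc 0 b, (Ioc 0 b).indicator H (s * x) :=
        setLIntegral_mono' measurableSet_Ioc hsub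
    _ ≤ ∫⁻ x, (Ioc 0 b).indicator H (s * x) := setLIntegral_le_lintegral _ _
    _ = ∫⁻ y, (Ioc 0 b).indicator H y ∂(volume.map (s * ·)) :=
        (lintegral_map (hH.indicator measurableSet_Ioc) (measurable_const_mul s)).symm
    _ = _ := by
        rw [Real.map_volume_mul_left hs.1.ne', lintegral_smul_measure,
          lintegral_indicator measurableSet_Ioc, abs_of_pos (inv_pos.2 hs.1), smul_eq_mul]

/-- Hölder's inequality for the Hardy operator with kernel `s ^ (-b)`. -/
theorem weighted_hardy_pointwise {p q b : ℝ} (h : p.HolderConjugate q) (hb : b < 1 / q)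
    {G : ℝ → ℝ≥0∞} (hG : Measurable G) :
    (∫⁻ s in Ioc (0 : ℝ) 1, ENNReal.ofReal (s ^ (-b)) * G s) ^ p ≤
      ENNReal.ofReal ((2 / (1 / q - b)) ^ (p - 1)) *
        ∫⁻ s in Ioc (0 : ℝ) 1, ENNReal.ofReal (s ^ ((1 / q - b) / 2 * p)) * G s ^ p := by
  have hp : 0 < p := h.pos
  have hq : 0 < q := h.symm.pos
  have hq1 : 1 < q := h.symm.lt
  set d := 1 / q - b with hd
  have hd0 : 0 < d := sub_pos.2 hb
  have hbq : (b + d / 2) * q = 1 - q * d / 2 := by rw [hd]; field_simp; ring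
  have hol := ENNReal.lintegral_mul_le_Lp_mul_Lq (volume.restrict (Ioc (0 : ℝ) 1)) h
    (f := fun s => ENNReal.ofReal (s ^ (d / 2)) * G s)
    (g := fun s => ENNReal.ofReal (s ^ (-(b + d / 2)))) (by fun_prop) (by fun_prop)
  have e1 : ∫⁻ s in Ioc (0 : ℝ) 1, ((fun s => ENNReal.ofReal (s ^ (d / 2)) * G s) *
      fun s => ENNReal.ofReal (s ^ (-(b + d / 2)))) s =
      ∫⁻ s in Ioc (0 : ℝ) 1, ENNReal.ofReal (s ^ (-b)) * G s := by
    refine setLIntegral_congr_fun measurableSet_Ioc fun s hs => ?_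
    simp only [Pi.mul_apply]
    rw [mul_right_comm, ← ENNReal.ofReal_mul (Real.rpow_nonneg hs.1.le _), ← Real.rpow_add hs.1]
    congr 3
    ring
  have e2 : ∫⁻ s in Ioc (0 : ℝ) 1, (ENNReal.ofReal (s ^ (d / 2)) * G s) ^ p =
      ∫⁻ s in Ioc (0 : ℝ) 1, ENNReal.ofReal (s ^ (d / 2 * p)) * G s ^ p := by
    refine setLIntegral_congr_fun measurableSet_Ioc fun s hs => ?_
    rw [ENNReal.mul_rpow_of_nonneg _ _ hp.le, ENNReal.ofReal_rpow_of_nonneg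
      (Real.rpow_nonneg hs.1.le _) hp.le, ← Real.rpow_mul hs.1.le]
  have e3 : ∫⁻ s in Ioc (0 : ℝ) 1, (ENNReal.ofReal (s ^ (-(b + d / 2)))) ^ q ≤
      ENNReal.ofReal (2 / d) := by
    have : ∫⁻ s in Ioc (0 : ℝ) 1, (ENNReal.ofReal (s ^ (-(b + d / 2)))) ^ q =
        ∫⁻ s in Ioc (0 : ℝ) 1, ENNReal.ofReal (s ^ (q * d / 2 - 1)) := by
      refine setLIntegral_congr_fun measurableSet_Ioc fun s hs => ?_
      rw [ENNReal.ofReal_rpow_of_nonneg (Real.rpow_nonneg hs.1.le _) hq.le,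
        ← Real.rpow_mul hs.1.le, neg_mul, hbq, neg_sub]
    have hqd : 0 < q * d / 2 := by positivity
    rw [this, lintegral_rpow_Ioc (by linarith) zero_le_one, Real.one_rpow, sub_add_cancel]
    refine ENNReal.ofReal_le_ofReal ?_
    rw [one_div_div]
    gcongr
    exact le_mul_of_one_le_left hd0.le hq1.le
  rw [e1, e2] at hol
  calc (∫⁻ s in Ioc (0 : ℝ) 1, ENNReal.ofReal (s ^ (-b)) * G s) ^ p
      ≤ ((∫⁻ s in Ioc (0 : ℝ) 1, ENNReal.ofReal (s ^ (d / 2 * p)) * G s ^ p) ^ (1 / p) *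
          ENNReal.ofReal (2 / d) ^ (1 / q)) ^ p := by
        gcongr
        exact hol.trans (by gcongr)
    _ = _ := by
        rw [ENNReal.mul_rpow_of_nonneg _ _ hp.le, ← ENNReal.rpow_mul, one_div_mul_cancel hp.ne',
          ENNReal.rpow_one, ← ENNReal.rpow_mul, mul_comm, ENNReal.ofReal_rpow_of_nonneg
          (by positivity) (by positivity)]
        congr 3
        have hpq := h.inv_add_inv_eq_one
        have hq' : 1 / q = 1 - 1 / p := by rw [one_div, one_div]; linarith
        rw [hq']
        field_simp

/-- The weighted Hardy inequality with kernel `s ^ (-b)`. -/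
theorem weighted_hardy_lintegral {p q b : ℝ} (h : p.HolderConjugate q) (hb : b < 1 / q)
    {G : ℝ → ℝ≥0∞} (hG : Measurable G) (c : ℝ) :
    ∫⁻ x in Ioc 0 c, (∫⁻ s in Ioc (0 : ℝ) 1, ENNReal.ofReal (s ^ (-b)) * G (s * x)) ^ p ≤
      ENNReal.ofReal ((2 / (1 / q - b)) ^ p) * ∫⁻ x in Ioc 0 c, G x ^ p := by
  have hp : 0 < p := h.pos
  have hp1 : 1 < p := h.lt
  set d := 1 / q - b with hd
  have hd0 : 0 < d := sub_pos.2 hb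
  have hGp : Measurable fun x => G x ^ p := hG.pow_const p
  have hm : Measurable (Function.uncurry fun x s : ℝ =>
      ENNReal.ofReal (s ^ (d / 2 * p)) * G (s * x) ^ p) := by
    simp only [Function.uncurry_def]
    fun_prop
  calc ∫⁻ x in Ioc 0 c, (∫⁻ s in Ioc (0 : ℝ) 1, ENNReal.ofReal (s ^ (-b)) * G (s * x)) ^ p
      ≤ ∫⁻ x in Ioc 0 c, ENNReal.ofReal ((2 / d) ^ (p - 1)) *
          ∫⁻ s in Ioc (0 : ℝ) 1, ENNReal.ofReal (s ^ (d / 2 * p)) * G (s * x) ^ p :=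
        lintegral_mono fun x => weighted_hardy_pointwise h hb (G := fun s => G (s * x))
          (hG.comp (measurable_mul_const x))
    _ = ENNReal.ofReal ((2 / d) ^ (p - 1)) * ∫⁻ s in Ioc (0 : ℝ) 1, ∫⁻ x in Ioc 0 c,
          ENNReal.ofReal (s ^ (d / 2 * p)) * G (s * x) ^ p := by
        have hm' : Measurable fun x : ℝ =>
            ∫⁻ s in Ioc (0 : ℝ) 1, ENNReal.ofReal (s ^ (d / 2 * p)) * G (s * x) ^ p :=
          hm.lintegral_prod_right'
        rw [lintegral_const_mul _ hm', lintegral_lintegral_swap hm.aemeasurable]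
    _ ≤ ENNReal.ofReal ((2 / d) ^ (p - 1)) * ∫⁻ s in Ioc (0 : ℝ) 1,
          ENNReal.ofReal (s ^ (d / 2 * p - 1)) * ∫⁻ x in Ioc 0 c, G x ^ p := by
        refine mul_le_mul' le_rfl ?_
        refine setLIntegral_mono' measurableSet_Ioc fun s hs => ?_
        have hGs : Measurable fun x => G (s * x) ^ p := hGp.comp (measurable_const_mul s)
        rw [lintegral_const_mul _ hGs, Real.rpow_sub_one hs.1.ne',
          div_eq_mul_inv (s ^ (d / 2 * p)) s, ENNReal.ofReal_mul (Real.rpow_nonneg hs.1.le _),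
          mul_assoc]
        gcongr
        exact setLIntegral_comp_mul_le hGp hs c
    _ = ENNReal.ofReal ((2 / d) ^ (p - 1) * (1 / (d / 2 * p))) * ∫⁻ x in Ioc 0 c, G x ^ p := by
        have hdp : 0 < d / 2 * p := by positivity
        rw [lintegral_mul_const _ (by fun_prop), lintegral_rpow_Ioc (by linarith) zero_le_one,
          Real.one_rpow, sub_add_cancel, ← mul_assoc, ENNReal.ofReal_mul (by positivity)]
    _ ≤ _ := by
        gcongr
        rw [Real.rpow_sub_one (by positivity) p, div_mul_eq_mul_div, mul_div_assoc]
        refine mul_le_of_le_one_right (by positivity) ?_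
        rw [div_div_eq_mul_div, div_le_one (by positivity), one_div,
          inv_mul_le_iff₀ (by positivity)]
        nlinarith

/-- The Hardy average with weight `s ^ (-b)`:
`x ↦ ∫₀¹ s ^ (-b) f (s x) ds = x ^ (b - 1) ∫₀ˣ t ^ (-b) f(t) dt`. -/
noncomputable def hardyFun (b : ℂ) (f : ℝ → ℂ) (x : ℝ) : ℂ :=
  ∫ s in Ioc (0 : ℝ) 1, (s : ℂ) ^ (-b) * f (s * x)

theorem ae_comp_mul_of_ae {P : ℝ → Prop} (h : ∀ᵐ x ∂halfLineMeasure, P x) {x : ℝ} (hx : 0 < x) :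
    ∀ᵐ s ∂volume.restrict (Ioc (0 : ℝ) 1), P (s * x) := by
  have h1 : ∀ᵐ t ∂(volume : Measure ℝ), t ∈ Ici (0 : ℝ) → P t :=
    (ae_restrict_iff' measurableSet_Ici).1 h
  have h2 : ∀ᵐ t ∂(volume.map (· * x)), t ∈ Ici (0 : ℝ) → P t := by
    rw [Real.map_volume_mul_right hx.ne']
    exact Measure.ae_smul_measure h1 _
  refine (ae_restrict_iff' measurableSet_Ioc).2 ?_
  filter_upwards [ae_of_ae_map (measurable_mul_const x).aemeasurable h2] with s hs hs'
  exact hs (mul_nonneg hs'.1.le hx.le)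

theorem hardyFun_congr {b : ℂ} {f g : ℝ → ℂ} (h : f =ᵐ[halfLineMeasure] g) {x : ℝ} (hx : 0 < x) :
    hardyFun b f x = hardyFun b g x := by
  refine integral_congr_ae ?_
  filter_upwards [ae_comp_mul_of_ae h hx] with s hs
  rw [hs]

theorem stronglyMeasurable_hardyKernel (b : ℂ) (f : LpLoc p) :
    StronglyMeasurable (Function.uncurry fun x s : ℝ => (s : ℂ) ^ (-b) * f (s * x)) := by
  have hf : Measurable f := f.stronglyMeasurable.measurable
  have : Measurable (Function.uncurry fun x s : ℝ => (s : ℂ) ^ (-b) * f (s * x)) := by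
    simp only [Function.uncurry_def]
    exact ((Complex.measurable_ofReal.comp measurable_snd).pow_const _).mul
      (hf.comp (measurable_snd.mul measurable_fst))
  exact this.stronglyMeasurable

theorem lintegral_enorm_hardyKernel (b : ℂ) (f : ℝ → ℂ) (x : ℝ) :
    ∫⁻ s in Ioc (0 : ℝ) 1, ‖(s : ℂ) ^ (-b) * f (s * x)‖ₑ =
      ∫⁻ s in Ioc (0 : ℝ) 1, ENNReal.ofReal (s ^ (-b.re)) * ‖f (s * x)‖ₑ := by
  refine setLIntegral_congr_fun measurableSet_Ioc fun s hs => ?_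
  rw [enorm_mul, ← ofReal_norm ((s : ℂ) ^ (-b)), Complex.norm_cpow_eq_rpow_re_of_pos hs.1,
    Complex.neg_re]

theorem lintegral_hardyKernel_le [hp : Fact (1 < p)] {b : ℂ} (hb : b.re < 1 / p.conjExponent)
    (f : LpLoc p) (j : ℕ) :
    (∫⁻ x in Icc (0 : ℝ) j,
      (∫⁻ s in Ioc (0 : ℝ) 1, ‖(s : ℂ) ^ (-b) * f (s * x)‖ₑ) ^ p) ^ (1 / p) ≤
      ENNReal.ofReal (2 / (1 / p.conjExponent - b.re)) *
        eLpNorm f (ENNReal.ofReal p) (volume.restrict (Icc (0 : ℝ) j)) := by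
  have hp0 : 0 < p := one_pos.trans hp.out
  have hd0 : 0 < 1 / p.conjExponent - b.re := sub_pos.2 hb
  have hpq : p.HolderConjugate p.conjExponent := Real.HolderConjugate.conjExponent hp.out
  have e : ENNReal.ofReal (2 / (1 / p.conjExponent - b.re)) =
      (ENNReal.ofReal ((2 / (1 / p.conjExponent - b.re)) ^ p)) ^ (1 / p) := by
    rw [ENNReal.ofReal_rpow_of_nonneg (by positivity) (by positivity),
      ← Real.rpow_mul (by positivity), mul_one_div_cancel hp0.ne', Real.rpow_one]
  rw [eLpNorm_eq_lintegral_rpow_enorm_toReal (by simpa using hp0) ENNReal.ofReal_ne_top,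
    ENNReal.toReal_ofReal hp0.le, restrict_Ioc_eq_restrict_Icc.symm, e,
    ← ENNReal.mul_rpow_of_nonneg _ _ (by positivity)]
  gcongr
  simp_rw [lintegral_enorm_hardyKernel]
  exact weighted_hardy_lintegral hpq hb f.stronglyMeasurable.enorm j

theorem integrable_hardyKernel [hp : Fact (1 < p)] {b : ℂ} (hb : b.re < 1 / p.conjExponent)
    (f : LpLoc p) : ∀ᵐ x ∂halfLineMeasure,
      Integrable (fun s : ℝ => (s : ℂ) ^ (-b) * f (s * x)) (volume.restrict (Ioc (0 : ℝ) 1)) := by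
  have hp0 : 0 < p := one_pos.trans hp.out
  change ∀ᵐ x ∂volume.restrict (Ici (0 : ℝ)), _
  rw [Ici_zero_eq_iUnion, ae_restrict_iUnion_iff]
  intro j
  have hK := stronglyMeasurable_hardyKernel b f
  have hlt := (lintegral_hardyKernel_le hb f j).trans_lt
    (ENNReal.mul_lt_top ENNReal.ofReal_lt_top (f.memLp j).2)
  rw [ENNReal.rpow_lt_top_iff_of_pos (by positivity)] at hlt
  have hm : Measurable fun x : ℝ =>
      (∫⁻ s in Ioc (0 : ℝ) 1, ‖(s : ℂ) ^ (-b) * f (s * x)‖ₑ) ^ p :=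
    (hK.enorm.lintegral_prod_right').pow_const p
  filter_upwards [ae_lt_top hm hlt.ne] with x hx
  rw [ENNReal.rpow_lt_top_iff_of_pos hp0] at hx
  exact ⟨(hK.comp_measurable measurable_prodMk_left).aestronglyMeasurable, hx⟩

theorem eLpNorm_hardyFun_le [hp : Fact (1 < p)] {b : ℂ} (hb : b.re < 1 / p.conjExponent)
    (f : LpLoc p) (j : ℕ) :
    eLpNorm (hardyFun b f) (ENNReal.ofReal p) (volume.restrict (Icc (0 : ℝ) j)) ≤
      ENNReal.ofReal (2 / (1 / p.conjExponent - b.re)) *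
        eLpNorm f (ENNReal.ofReal p) (volume.restrict (Icc (0 : ℝ) j)) := by
  have hp0 : 0 < p := one_pos.trans hp.out
  refine le_trans ?_ (lintegral_hardyKernel_le hb f j)
  rw [eLpNorm_eq_lintegral_rpow_enorm_toReal (by simpa using hp0) ENNReal.ofReal_ne_top,
    ENNReal.toReal_ofReal hp0.le]
  gcongr with x
  exact enorm_integral_le_lintegral_enorm _

theorem memLp_hardyFun [Fact (1 < p)] {b : ℂ} (hb : b.re < 1 / p.conjExponent) (f : LpLoc p)
    (j : ℕ) : MemLp (hardyFun b f) (ENNReal.ofReal p) (volume.restrict (Icc (0 : ℝ) j)) :=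
  ⟨(stronglyMeasurable_hardyKernel b f).integral_prod_right'.aestronglyMeasurable,
    (eLpNorm_hardyFun_le hb f j).trans_lt
      (ENNReal.mul_lt_top ENNReal.ofReal_lt_top (f.memLp j).2)⟩

/-- The weighted Hardy operator as a linear map on `LpLoc p`. -/
noncomputable def hardyLinear [Fact (1 < p)] {b : ℂ} (hb : b.re < 1 / p.conjExponent) :
    LpLoc p →ₗ[ℂ] LpLoc p where
  toFun f := ofMemLp (hardyFun b f) (memLp_hardyFun hb f)
  map_add' f g := by
    apply ext
    filter_upwards [coeFn_ofMemLp _ (memLp_hardyFun hb (f + g)),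
      coeFn_ofMemLp _ (memLp_hardyFun hb f), coeFn_ofMemLp _ (memLp_hardyFun hb g),
      coeFn_add (ofMemLp _ (memLp_hardyFun hb f)) (ofMemLp _ (memLp_hardyFun hb g)),
      integrable_hardyKernel hb f, integrable_hardyKernel hb g, ae_halfLine_pos]
      with x h1 h2 h3 h4 h5 h6 hx
    rw [h1, h4, h2, h3, hardyFun_congr (coeFn_add f g) hx, hardyFun, hardyFun, hardyFun,
      ← integral_add h5 h6]
    simp_rw [mul_add]
  map_smul' c f := by
    apply ext
    rw [RingHom.id_apply]
    filter_upwards [coeFn_ofMemLp _ (memLp_hardyFun hb (c • f)),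
      coeFn_ofMemLp _ (memLp_hardyFun hb f), coeFn_smul c (ofMemLp _ (memLp_hardyFun hb f)),
      ae_halfLine_pos] with x h1 h2 h3 hx
    rw [h1, h3, h2, hardyFun_congr (coeFn_smul c f) hx, hardyFun, hardyFun, ← integral_const_mul]
    congr 1
    ext s
    ring

theorem coeFn_hardyLinear [Fact (1 < p)] {b : ℂ} (hb : b.re < 1 / p.conjExponent) (f : LpLoc p) :
    hardyLinear hb f =ᵐ[halfLineMeasure] hardyFun b f :=
  coeFn_ofMemLp _ (memLp_hardyFun hb f)

theorem seminorm_hardyLinear_le [Fact (1 < p)] {b : ℂ} (hb : b.re < 1 / p.conjExponent)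
    (f : LpLoc p) (j : ℕ) :
    seminorm p j (hardyLinear hb f) ≤ 2 / (1 / p.conjExponent - b.re) * seminorm p j f := by
  have hd0 : 0 < 1 / p.conjExponent - b.re := sub_pos.2 hb
  rw [seminorm_apply, seminorm_apply,
    eLpNorm_congr_ae (coeFn_ae_Icc (coeFn_hardyLinear hb f) j)]
  refine (ENNReal.toReal_mono (ENNReal.mul_ne_top ENNReal.ofReal_ne_top (f.memLp j).2.ne)
    (eLpNorm_hardyFun_le hb f j)).trans ?_
  rw [ENNReal.toReal_mul, ENNReal.toReal_ofReal (by positivity)]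

/-- The weighted Hardy operator as a continuous linear operator on `LpLoc p`. -/
noncomputable def hardy [Fact (1 < p)] {b : ℂ} (hb : b.re < 1 / p.conjExponent) :
    LpLoc p →L[ℂ] LpLoc p where
  toLinearMap := hardyLinear hb
  cont := by
    refine WithSeminorms.continuous_of_isBounded withSeminorms withSeminorms (hardyLinear hb)
      fun j => ⟨{j}, ⟨2 / (1 / p.conjExponent - b.re),
        div_nonneg zero_le_two (sub_pos.2 hb).le⟩, fun f => ?_⟩
    rw [Finset.sup_singleton]
    exact seminorm_hardyLinear_le hb f j

theorem one_div_conjExponent [hp : Fact (1 < p)] : 1 / p.conjExponent = 1 - 1 / p := by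
  have := (Real.HolderConjugate.conjExponent hp.out).inv_add_inv_eq_one
  rw [one_div, one_div]
  linarith

theorem hardy_power [hp : Fact (1 < p)] {b a : ℂ} (hb : b.re < 1 / p.conjExponent)
    (ha : -(1 / p) < a.re) : hardy hb (power p a) = (a + 1 - b)⁻¹ • power p a := by
  have hb' := hb
  rw [one_div_conjExponent] at hb'
  apply ext
  filter_upwards [coeFn_hardyLinear hb (power p a),
    coeFn_smul (a + 1 - b)⁻¹ (power p a), coeFn_power ha, ae_halfLine_pos] with x h1 h2 h3 hx
  change hardyLinear hb (power p a) x = _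
  refine h1.trans ?_
  have hre : -1 < (a - b).re := by rw [Complex.sub_re]; linarith
  have hne : a - b + 1 ≠ 0 := by
    intro h
    have := congrArg Complex.re h
    simp only [Complex.add_re, Complex.one_re, Complex.zero_re] at this
    linarith
  have e : hardyFun b (fun x : ℝ => (x : ℂ) ^ a) x =
      ∫ s in Ioc (0 : ℝ) 1, (s : ℂ) ^ (a - b) * (x : ℂ) ^ a := by
    refine setIntegral_congr_fun measurableSet_Ioc fun s hs => ?_
    have hs0 : (s : ℂ) ≠ 0 := by exact_mod_cast hs.1.ne'
    simp only
    rw [Complex.ofReal_mul, Complex.mul_cpow_ofReal_nonneg hs.1.le hx.le, sub_eq_add_neg,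
      Complex.cpow_add _ _ hs0]
    ring
  rw [h2, h3, hardyFun_congr (coeFn_power ha) hx, e, integral_mul_const,
    ← intervalIntegral.integral_of_le zero_le_one, integral_cpow (Or.inl hre), Complex.ofReal_zero,
    Complex.zero_cpow hne, Complex.ofReal_one, Complex.one_cpow, sub_zero, one_div,
    sub_add_eq_add_sub]

theorem neg_one_div_lt_natCast [hp : Fact (1 < p)] (n : ℕ) : -(1 / p) < (n : ℂ).re := by
  have hp0 : 0 < p := one_pos.trans hp.out
  have : 0 < 1 / p := by positivity
  rw [Complex.natCast_re]
  linarith [n.cast_nonneg (α := ℝ)]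

/-- The resolvent of the Cesàro operator at `b⁻¹`, for `Re b < 1/q`. -/
noncomputable def resolventOp [Fact (1 < p)] {b : ℂ} (hb : b.re < 1 / p.conjExponent) :
    LpLoc p →L[ℂ] LpLoc p := b • (1 : LpLoc p →L[ℂ] LpLoc p) + b ^ 2 • hardy hb

theorem resolventOp_power [hp : Fact (1 < p)] {b a : ℂ} (hb : b.re < 1 / p.conjExponent)
    (hb0 : b ≠ 0) (ha : -(1 / p) < a.re) :
    resolventOp hb (power p a) = (b⁻¹ - (a + 1)⁻¹)⁻¹ • power p a := by
  have ha1 := add_one_ne_zero ha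
  have hab : a + 1 - b ≠ 0 := by
    intro h
    have := congrArg Complex.re h
    rw [one_div_conjExponent] at hb
    simp only [Complex.add_re, Complex.sub_re, Complex.one_re, Complex.zero_re] at this
    linarith
  change b • power p a + b ^ 2 • hardy hb (power p a) = _
  rw [hardy_power hb ha, smul_smul, ← add_smul, inv_sub_inv hb0 ha1, inv_div]
  congr 1
  field_simp
  ring

theorem inv_sub_inv_ne_zero [hp : Fact (1 < p)] {b a : ℂ} (hb : b.re < 1 / p.conjExponent)
    (ha : -(1 / p) < a.re) : b⁻¹ - (a + 1)⁻¹ ≠ 0 := by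
  intro h
  have h := congrArg Complex.re (inv_injective (sub_eq_zero.1 h))
  rw [one_div_conjExponent] at hb
  simp only [Complex.add_re, Complex.one_re] at h
  linarith

theorem sub_cesaro_power [Fact (1 < p)] (μ : ℂ) {a : ℂ} (ha : -(1 / p) < a.re) :
    (μ • (1 : LpLoc p →L[ℂ] LpLoc p) - cesaro p) (power p a) =
      (μ - (a + 1)⁻¹) • power p a := by
  change μ • power p a - cesaro p (power p a) = _
  rw [cesaro_power ha, sub_smul]

theorem resolventOp_mul_sub [Fact (1 < p)] {b : ℂ} (hb : b.re < 1 / p.conjExponent)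
    (hb0 : b ≠ 0) : resolventOp hb * (b⁻¹ • (1 : LpLoc p →L[ℂ] LpLoc p) - cesaro p) = 1 := by
  refine ContinuousLinearMap.ext_on dense_span_natPower ?_
  rintro _ ⟨n, rfl⟩
  have hn := neg_one_div_lt_natCast (p := p) n
  change resolventOp hb ((b⁻¹ • (1 : LpLoc p →L[ℂ] LpLoc p) - cesaro p) (power p n)) = power p n
  rw [sub_cesaro_power _ hn, map_smul, resolventOp_power hb hb0 hn, smul_smul,
    mul_inv_cancel₀ (inv_sub_inv_ne_zero hb hn), one_smul]

theorem sub_mul_resolventOp [Fact (1 < p)] {b : ℂ} (hb : b.re < 1 / p.conjExponent)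
    (hb0 : b ≠ 0) : (b⁻¹ • (1 : LpLoc p →L[ℂ] LpLoc p) - cesaro p) * resolventOp hb = 1 := by
  refine ContinuousLinearMap.ext_on dense_span_natPower ?_
  rintro _ ⟨n, rfl⟩
  have hn := neg_one_div_lt_natCast (p := p) n
  change (b⁻¹ • (1 : LpLoc p →L[ℂ] LpLoc p) - cesaro p) (resolventOp hb (power p n)) = power p n
  rw [resolventOp_power hb hb0 hn, map_smul, sub_cesaro_power _ hn, smul_smul,
    inv_mul_cancel₀ (inv_sub_inv_ne_zero hb hn), one_smul]

theorem isUnit_sub_cesaro [Fact (1 < p)] {μ : ℂ} (hμ : μ ≠ 0)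
    (h : (μ⁻¹).re < 1 / p.conjExponent) :
    IsUnit (μ • (1 : LpLoc p →L[ℂ] LpLoc p) - cesaro p) := by
  have h1 := resolventOp_mul_sub h (inv_ne_zero hμ)
  have h2 := sub_mul_resolventOp h (inv_ne_zero hμ)
  rw [inv_inv] at h1 h2
  exact ⟨⟨_, _, h2, h1⟩, rfl⟩

theorem seminorm_resolventOp_le [Fact (1 < p)] {b : ℂ} (hb : b.re < 1 / p.conjExponent)
    (f : LpLoc p) (j : ℕ) : seminorm p j (resolventOp hb f) ≤
      (‖b‖ + ‖b‖ ^ 2 * (2 / (1 / p.conjExponent - b.re))) * seminorm p j f := by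
  refine (map_add_le_add (seminorm p j) (b • f) (b ^ 2 • hardy hb f)).trans ?_
  rw [map_smul_eq_mul, map_smul_eq_mul, norm_pow, add_mul, mul_assoc (‖b‖ ^ 2)]
  gcongr
  exact seminorm_hardyLinear_le hb f j

/-- Limits of eigenvalues whose eigenfunctions `x ^ a` have bounded `Re a` lie in the spectrum. -/
theorem not_isUnit_sub_cesaro_of_tendsto [hp : Fact (1 < p)] {μ : ℂ} {a : ℕ → ℂ} {R : ℝ}
    (ha : ∀ n, -(1 / p) < (a n).re) (hR : ∀ n, (a n).re ≤ R)
    (hlim : Tendsto (fun n => (a n + 1)⁻¹) atTop (𝓝 μ)) :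
    ¬ IsUnit (μ • (1 : LpLoc p →L[ℂ] LpLoc p) - cesaro p) := by
  rintro ⟨u, hu⟩
  set S : LpLoc p →L[ℂ] LpLoc p := ↑u⁻¹ with hS
  have hSu : ∀ f, S ((μ • (1 : LpLoc p →L[ℂ] LpLoc p) - cesaro p) f) = f := fun f => by
    have := u.inv_mul
    rw [hu] at this
    exact DFunLike.congr_fun this f
  obtain ⟨s, C, -, hC⟩ := Seminorm.bound_of_continuous withSeminorms
    ((seminorm p 1).comp S.toLinearMap) ((continuous_seminorm 1).comp S.continuous)
  obtain ⟨k, hk⟩ := finset_sup_seminorm_le (p := p) s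
  have hle : ∀ n, 1 ≤ ‖μ - (a n + 1)⁻¹‖ * (C * ((k : ℝ) + 1) ^ (R + 1 / p)) := fun n => by
    have hpos := seminorm_one_power_pos (ha n)
    have h1 : (μ - (a n + 1)⁻¹) • S (power p (a n)) = power p (a n) := by
      rw [← map_smul, ← sub_cesaro_power μ (ha n), hSu]
    have h2 : seminorm p 1 (S (power p (a n))) ≤
        C * (((k : ℝ) + 1) ^ (R + 1 / p) * seminorm p 1 (power p (a n))) := by
      refine (hC (power p (a n))).trans ?_
      change (C : ℝ) * s.sup (seminorm p) (power p (a n)) ≤ _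
      gcongr
      refine (hk (power p (a n))).trans ?_
      rw [seminorm_power_eq (ha n) k]
      gcongr
      calc (k : ℝ) ^ ((a n).re + 1 / p) ≤ ((k : ℝ) + 1) ^ ((a n).re + 1 / p) :=
            Real.rpow_le_rpow k.cast_nonneg (by linarith) (by linarith [ha n])
        _ ≤ _ := Real.rpow_le_rpow_of_exponent_le (by linarith [k.cast_nonneg (α := ℝ)])
            (by linarith [hR n])
    have h3 : seminorm p 1 (power p (a n)) ≤
        ‖μ - (a n + 1)⁻¹‖ * (C * ((k : ℝ) + 1) ^ (R + 1 / p)) * seminorm p 1 (power p (a n)) := by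
      conv_lhs => rw [← h1]
      rw [map_smul_eq_mul, mul_assoc, mul_assoc]
      gcongr
    exact (le_mul_iff_one_le_left hpos).1 h3
  have hz : Tendsto (fun n => ‖μ - (a n + 1)⁻¹‖ * (C * ((k : ℝ) + 1) ^ (R + 1 / p))) atTop
      (𝓝 0) := by
    have := ((hlim.const_sub μ).norm).mul_const (C * ((k : ℝ) + 1) ^ (R + 1 / p))
    simpa using this
  have := ge_of_tendsto' hz hle
  linarith

/-- `μ` is no eigenvalue if it is approached from the resolvent set, at controlled distance. -/
theorem eq_zero_of_cesaro_eq_smul [Fact (1 < p)] {μ : ℂ} {b : ℕ → ℂ}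
    (hb : ∀ k, (b k).re < 1 / p.conjExponent) (hb0 : ∀ k, b k ≠ 0)
    (hlim : Tendsto (fun k => (b k)⁻¹) atTop (𝓝 μ)) {M : ℝ}
    (hM : ∀ k, ‖(b k)⁻¹ - μ‖ * (‖b k‖ + ‖b k‖ ^ 2 * (2 / (1 / p.conjExponent - (b k).re))) ≤ M)
    (hμ : ∀ n : ℕ, μ ≠ ((n : ℂ) + 1)⁻¹) {f : LpLoc p} (hf : cesaro p f = μ • f) : f = 0 := by
  have hfix : ∀ k, ((b k)⁻¹ - μ) • resolventOp (hb k) f = f := fun k => by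
    rw [← map_smul, sub_smul, ← hf]
    exact DFunLike.congr_fun (resolventOp_mul_sub (hb k) (hb0 k)) f
  have hspan : ∀ u ∈ Submodule.span ℂ (range fun n : ℕ => power p (n : ℂ)),
      Tendsto (fun k => ((b k)⁻¹ - μ) • resolventOp (hb k) u) atTop (𝓝 0) := by
    intro u hu
    induction hu using Submodule.span_induction with
    | mem x hx =>
      obtain ⟨n, rfl⟩ := hx
      simp_rw [resolventOp_power (hb _) (hb0 _) (neg_one_div_lt_natCast n), smul_smul]
      have h1 : Tendsto (fun k => ((b k)⁻¹ - μ) * ((b k)⁻¹ - ((n : ℂ) + 1)⁻¹)⁻¹) atTop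
          (𝓝 ((μ - μ) * (μ - ((n : ℂ) + 1)⁻¹)⁻¹)) :=
        (hlim.sub_const μ).mul ((hlim.sub_const _).inv₀ (sub_ne_zero.2 (hμ n)))
      simpa using h1.smul_const (power p (n : ℂ))
    | zero => simp
    | add x y _ _ hx hy => simpa using hx.add hy
    | smul c x _ hx =>
      refine (by simpa using hx.const_smul c : Tendsto (fun k => c • ((b k)⁻¹ - μ) •
        resolventOp (hb k) x) atTop (𝓝 0)).congr fun k => ?_
      rw [map_smul, smul_comm]
  have hMj : ∀ (k : ℕ) (g : LpLoc p) (j : ℕ),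
      seminorm p j (((b k)⁻¹ - μ) • resolventOp (hb k) g) ≤ M * seminorm p j g := fun k g j => by
    rw [map_smul_eq_mul]
    refine (mul_le_mul_of_nonneg_left (seminorm_resolventOp_le (hb k) g j)
      (norm_nonneg _)).trans ?_
    rw [← mul_assoc]
    exact mul_le_mul_of_nonneg_right (hM k) (apply_nonneg _ _)
  refine ext_of_restr fun j => ?_
  rw [map_zero, ← norm_eq_zero, norm_restr]
  refine le_antisymm (le_of_forall_pos_le_add fun ε hε => ?_) (apply_nonneg _ _)
  have hM0 : 0 < |M| + 1 := by positivity
  obtain ⟨u, hu, hfu⟩ := mem_closure_iff_seminorm.1 (dense_span_natPower f) j (ε / (|M| + 1))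
    (by positivity)
  have hlim' : Tendsto (fun k => M * (ε / (|M| + 1)) +
      seminorm p j (((b k)⁻¹ - μ) • resolventOp (hb k) u)) atTop
      (𝓝 (M * (ε / (|M| + 1)) + 0)) := by
    refine Tendsto.const_add _ ?_
    simpa [Function.comp_def] using ((continuous_seminorm (p := p) j).tendsto _).comp (hspan u hu)
  have hM' : 0 ≤ M := by
    refine le_trans (mul_nonneg (norm_nonneg _) ?_) (hM 0)
    have := sub_pos.2 (hb 0)
    positivity
  have hle := ge_of_tendsto' hlim' (b := seminorm p j f) fun k => by
    calc seminorm p j f = seminorm p j (((b k)⁻¹ - μ) • resolventOp (hb k) (f - u) +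
          ((b k)⁻¹ - μ) • resolventOp (hb k) u) := by
          rw [← smul_add, ← map_add, sub_add_cancel, hfix]
      _ ≤ _ := map_add_le_add _ _ _
      _ ≤ M * seminorm p j (f - u) + _ := by gcongr; exact hMj k _ j
      _ ≤ _ := by
        rw [map_sub_rev]
        gcongr
  refine hle.trans ?_
  rw [add_zero, zero_add, ← mul_div_assoc, div_le_iff₀ hM0, mul_comm]
  gcongr
  rw [abs_of_nonneg hM']
  linarith

theorem norm_sub_half_lt_iff {q : ℝ} (hq : 0 < q) {μ : ℂ} (hμ : μ ≠ 0) :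
    ‖μ - (q / 2 : ℝ)‖ < q / 2 ↔ 1 / q < (μ⁻¹).re := by
  have hN : 0 < Complex.normSq μ := Complex.normSq_pos.2 hμ
  rw [Complex.inv_re, div_lt_div_iff₀ hq hN, ← sq_lt_sq₀ (norm_nonneg _) (by positivity),
    ← Complex.normSq_eq_norm_sq, Complex.normSq_apply, Complex.normSq_apply]
  simp only [Complex.sub_re, Complex.sub_im, Complex.ofReal_re, Complex.ofReal_im]
  constructor <;> intro h <;> nlinarith

theorem norm_sub_half_le_iff {q : ℝ} (hq : 0 < q) {μ : ℂ} (hμ : μ ≠ 0) :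
    ‖μ - (q / 2 : ℝ)‖ ≤ q / 2 ↔ 1 / q ≤ (μ⁻¹).re := by
  have hN : 0 < Complex.normSq μ := Complex.normSq_pos.2 hμ
  rw [Complex.inv_re, div_le_div_iff₀ hq hN, ← sq_le_sq₀ (norm_nonneg _) (by positivity),
    ← Complex.normSq_eq_norm_sq, Complex.normSq_apply, Complex.normSq_apply]
  simp only [Complex.sub_re, Complex.sub_im, Complex.ofReal_re, Complex.ofReal_im]
  constructor <;> intro h <;> nlinarith

theorem conjExponent_pos [hp : Fact (1 < p)] : 0 < p.conjExponent :=
  (Real.HolderConjugate.conjExponent hp.out).symm.pos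

theorem not_isUnit_sub_cesaro [hp : Fact (1 < p)] {μ : ℂ}
    (h : μ = 0 ∨ 1 / p.conjExponent ≤ (μ⁻¹).re) :
    ¬ IsUnit (μ • (1 : LpLoc p →L[ℂ] LpLoc p) - cesaro p) := by
  have hp0 : 0 < p := one_pos.trans hp.out
  by_cases hμ : μ = 0
  · subst hμ
    refine not_isUnit_sub_cesaro_of_tendsto (a := fun n : ℕ => (n : ℂ) * Complex.I) (R := 0)
      (fun n => ?_) (fun n => ?_) ?_
    · have : 0 < 1 / p := by positivity
      simpa using this
    · simp
    · refine tendsto_inv₀_cobounded.comp (tendsto_norm_atTop_iff_cobounded.1 ?_)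
      refine tendsto_atTop_mono (fun n => ?_) tendsto_natCast_atTop_atTop
      have := Complex.abs_im_le_norm ((n : ℂ) * Complex.I + 1)
      simpa using this
  · have h := h.resolve_left hμ
    rw [one_div_conjExponent] at h
    have hpos : ∀ n : ℕ, (0 : ℝ) < 1 / ((n : ℝ) + 1) := fun n => by positivity
    have hle : ∀ n : ℕ, 1 / ((n : ℝ) + 1) ≤ 1 := fun n =>
      (div_le_one (by positivity)).2 (by linarith [n.cast_nonneg (α := ℝ)])
    refine not_isUnit_sub_cesaro_of_tendsto
      (a := fun n : ℕ => μ⁻¹ - 1 + ((1 / ((n : ℝ) + 1) : ℝ) : ℂ)) (R := (μ⁻¹).re)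
      (fun n => ?_) (fun n => ?_) ?_
    · simp only [Complex.add_re, Complex.sub_re, Complex.one_re, Complex.ofReal_re]
      linarith [hpos n]
    · simp only [Complex.add_re, Complex.sub_re, Complex.one_re, Complex.ofReal_re]
      linarith [hle n]
    · have h1 : Tendsto (fun n : ℕ => μ⁻¹ - 1 + ((1 / ((n : ℝ) + 1) : ℝ) : ℂ) + 1) atTop
          (𝓝 μ⁻¹) := by
        have := ((Complex.continuous_ofReal.tendsto 0).comp
          (tendsto_one_div_add_atTop_nhds_zero_nat (𝕜 := ℝ))).const_add (μ⁻¹ - 1)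
        simpa using this.add_const 1
      simpa using h1.inv₀ (inv_ne_zero hμ)

theorem spectrum_cesaro [Fact (1 < p)] : spectrum ℂ (cesaro p) =
    {μ : ℂ | ‖μ - (p.conjExponent / 2 : ℝ)‖ ≤ p.conjExponent / 2} := by
  have hq := conjExponent_pos (p := p)
  ext μ
  rw [spectrum.mem_iff, Algebra.algebraMap_eq_smul_one, mem_ofPred_eq]
  by_cases hμ : μ = 0
  · refine iff_of_true (not_isUnit_sub_cesaro (Or.inl hμ)) ?_
    rw [hμ, zero_sub, norm_neg, Complex.norm_real, Real.norm_of_nonneg (by positivity)]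
  · rw [norm_sub_half_le_iff hq hμ]
    refine ⟨fun h => ?_, fun h => not_isUnit_sub_cesaro (Or.inr h)⟩
    by_contra! hlt
    exact h (isUnit_sub_cesaro hμ hlt)

theorem eq_zero_of_cesaro_eq_zero [hp : Fact (1 < p)] {f : LpLoc p} (hf : cesaro p f = 0) :
    f = 0 := by
  have hq := conjExponent_pos (p := p)
  have hq' : 0 < 1 / p.conjExponent := by positivity
  have hb0 : ∀ k : ℕ, -((k : ℂ) + 1) ≠ 0 := fun k => neg_ne_zero.2 k.cast_add_one_ne_zero
  have hnorm : ∀ k : ℕ, ‖-((k : ℂ) + 1)‖ = (k : ℝ) + 1 := fun k => by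
    rw [norm_neg, ← Nat.cast_succ, Complex.norm_natCast, Nat.cast_succ]
  have hre : ∀ k : ℕ, (-((k : ℂ) + 1)).re = -((k : ℝ) + 1) := fun k => by simp
  refine eq_zero_of_cesaro_eq_smul (μ := 0) (b := fun k : ℕ => -((k : ℂ) + 1)) (M := 3)
    (fun k => ?_) hb0 ?_ (fun k => ?_) (fun n => ?_) (by rw [hf, zero_smul])
  · rw [hre]
    linarith [k.cast_nonneg (α := ℝ)]
  · refine tendsto_inv₀_cobounded.comp (tendsto_norm_atTop_iff_cobounded.1 ?_)
    simp_rw [hnorm]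
    exact tendsto_atTop_add_const_right _ _ tendsto_natCast_atTop_atTop
  · rw [sub_zero, norm_inv, hnorm, hre, sub_neg_eq_add]
    have hk : (0 : ℝ) < (k : ℝ) + 1 := by positivity
    have e : ((k : ℝ) + 1)⁻¹ * ((k : ℝ) + 1 + ((k : ℝ) + 1) ^ 2 *
        (2 / (1 / p.conjExponent + ((k : ℝ) + 1)))) =
        1 + 2 * (((k : ℝ) + 1) / (1 / p.conjExponent + ((k : ℝ) + 1))) := by
      field_simp
    rw [e]
    have := (div_le_one (by positivity : (0 : ℝ) < 1 / p.conjExponent + ((k : ℝ) + 1))).2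
      (by linarith : (k : ℝ) + 1 ≤ _)
    linarith
  · exact (inv_ne_zero n.cast_add_one_ne_zero).symm

theorem eq_zero_of_cesaro_eq_smul_of_re_inv_eq [hp : Fact (1 < p)] {μ : ℂ}
    (hμ : (μ⁻¹).re = 1 / p.conjExponent) {f : LpLoc p} (hf : cesaro p f = μ • f) : f = 0 := by
  have hp0 : 0 < p := one_pos.trans hp.out
  have hq := conjExponent_pos (p := p)
  set r := 1 / p.conjExponent with hr
  have hr0 : 0 < r := by positivity
  have hr1 : r < 1 := by
    rw [hr, one_div_conjExponent]
    have : 0 < 1 / p := by positivity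
    linarith
  set a := μ⁻¹ with ha
  have ha0 : a ≠ 0 := fun h => by rw [h, Complex.zero_re] at hμ; exact hr0.ne hμ
  have hna : 0 < ‖a‖ := norm_pos_iff.2 ha0
  set e : ℕ → ℝ := fun k => r / 2 * (1 / ((k : ℝ) + 1)) with he
  have he0 : ∀ k, 0 < e k := fun k => by positivity
  have he1 : ∀ k, e k ≤ r / 2 := fun k =>
    mul_le_of_le_one_right (by positivity)
      ((div_le_one (by positivity)).2 (by linarith [k.cast_nonneg (α := ℝ)]))
  have hre : ∀ k, (a - (e k : ℂ)).re = r - e k := fun k => by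
    rw [Complex.sub_re, Complex.ofReal_re, hμ]
  have hb0 : ∀ k, a - (e k : ℂ) ≠ 0 := fun k h => by
    have := hre k
    rw [h, Complex.zero_re] at this
    linarith [he1 k]
  refine eq_zero_of_cesaro_eq_smul (μ := μ) (b := fun k : ℕ => a - (e k : ℂ))
    (M := (1 + 2 * (‖a‖ + 1)) / ‖a‖) (fun k => ?_) hb0 ?_ (fun k => ?_) (fun n hn => ?_) hf
  · rw [hre]
    linarith [he0 k]
  · have h1 : Tendsto e atTop (𝓝 0) := by
      simpa [he] using (tendsto_one_div_add_atTop_nhds_zero_nat (𝕜 := ℝ)).const_mul (r / 2)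
    have h2 : Tendsto (fun k => a - (e k : ℂ)) atTop (𝓝 a) := by
      simpa using ((Complex.continuous_ofReal.tendsto 0).comp h1).const_sub a
    simpa [ha] using h2.inv₀ ha0
  · have hnb : 0 < ‖a - (e k : ℂ)‖ := norm_pos_iff.2 (hb0 k)
    have h1 : ‖(a - (e k : ℂ))⁻¹ - μ‖ = e k / (‖a - (e k : ℂ)‖ * ‖a‖) := by
      rw [← inv_inv μ, ← ha, inv_sub_inv (hb0 k) ha0, sub_sub_cancel, norm_div, norm_mul,
        Complex.norm_real, Real.norm_of_nonneg (he0 k).le]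
    have h2 : ‖a - (e k : ℂ)‖ ≤ ‖a‖ + 1 := by
      refine (norm_sub_le _ _).trans ?_
      rw [Complex.norm_real, Real.norm_of_nonneg (he0 k).le]
      linarith [he1 k]
    have h3 : e k / (‖a - (e k : ℂ)‖ * ‖a‖) *
        (‖a - (e k : ℂ)‖ + ‖a - (e k : ℂ)‖ ^ 2 * (2 / e k)) =
        (e k + 2 * ‖a - (e k : ℂ)‖) / ‖a‖ := by
      have := (he0 k).ne'
      field_simp
    rw [h1, hre, sub_sub_cancel, h3]
    gcongr
    linarith [he1 k]
  · rw [ha, hn, inv_inv] at hμ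
    simp only [Complex.add_re, Complex.natCast_re, Complex.one_re] at hμ
    linarith [n.cast_nonneg (α := ℝ)]

theorem power_ne_zero [Fact (1 < p)] {a : ℂ} (ha : -(1 / p) < a.re) : power p a ≠ 0 := fun h => by
  have := seminorm_one_power_pos ha
  rw [h, map_zero] at this
  exact this.false

theorem pointSpectrum_cesaro [hp : Fact (1 < p)] : pointSpectrum (cesaro p) =
    {μ : ℂ | ‖μ - (p.conjExponent / 2 : ℝ)‖ < p.conjExponent / 2} := by
  have hq := conjExponent_pos (p := p)
  ext μ
  rw [mem_ofPred_eq]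
  change ¬ Function.Injective (μ • (1 : LpLoc p →L[ℂ] LpLoc p) - cesaro p) ↔ _
  have hker : ∀ {f : LpLoc p}, (μ • (1 : LpLoc p →L[ℂ] LpLoc p) - cesaro p) f = 0 →
      cesaro p f = μ • f := fun h => (sub_eq_zero.1 h).symm
  by_cases hμ : μ = 0
  · refine iff_of_false (not_not.2 ((injective_iff_map_eq_zero _).2 fun f hf => ?_)) ?_
    · exact eq_zero_of_cesaro_eq_zero (by rw [hker hf, hμ, zero_smul])
    · rw [hμ, zero_sub, norm_neg, Complex.norm_real, Real.norm_of_nonneg (by positivity)]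
      exact lt_irrefl _
  · rw [norm_sub_half_lt_iff hq hμ]
    constructor
    · contrapose!
      intro h
      rcases h.lt_or_eq with h | h
      · obtain ⟨u, hu⟩ := isUnit_sub_cesaro hμ h
        refine Function.LeftInverse.injective (g := (↑u⁻¹ : LpLoc p →L[ℂ] LpLoc p)) fun f => ?_
        have := u.inv_mul
        rw [hu] at this
        exact DFunLike.congr_fun this f
      · exact (injective_iff_map_eq_zero _).2 fun f hf =>
          eq_zero_of_cesaro_eq_smul_of_re_inv_eq h (hker hf)
    · intro h hinj
      have ha : -(1 / p) < (μ⁻¹ - 1).re := by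
        rw [one_div_conjExponent] at h
        rw [Complex.sub_re, Complex.one_re]
        linarith
      refine power_ne_zero ha ((injective_iff_map_eq_zero _).1 hinj _ ?_)
      rw [sub_cesaro_power μ ha, sub_add_cancel, inv_inv, sub_self, zero_smul]

theorem frequently_nhdsNE_of_isOpen {A : Set ℂ} (hA : IsOpen A) {z : ℂ} (hz : z ∈ A) :
    ∃ᶠ w in 𝓝[≠] z, w ∈ A :=
  Eventually.frequently (mem_nhdsWithin_of_mem_nhds (hA.mem_nhds hz))

theorem isHypercyclic_cesaro [hp : Fact (1 < p)] : IsHypercyclic (cesaro p) := by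
  have hp0 : 0 < p := one_pos.trans hp.out
  have hpp : 0 < 1 / p := by positivity
  have hp1 : 1 / p < 1 := (div_lt_one hp0).2 hp.out
  have ho : IsOpen {a : ℂ | -(1 / p) < a.re} := isOpen_lt continuous_const Complex.continuous_re
  have hn : Continuous fun a : ℂ => ‖a + 1‖ := by fun_prop
  refine isHypercyclic_of_dense_eigen _ ?_ ?_
  · have hz : -(1 / p) < (1 : ℂ).re := by rw [Complex.one_re]; linarith
    refine (dense_span_power hz (frequently_nhdsNE_of_isOpen
      (ho.inter (isOpen_lt continuous_const hn : IsOpen {a : ℂ | 1 < ‖a + 1‖}))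
      ⟨hz, ?_⟩)).mono (Submodule.span_mono ?_)
    · norm_num
    · rintro _ ⟨a, ⟨ha, ha'⟩, rfl⟩
      exact ⟨_, by rw [norm_inv]; exact inv_lt_one_of_one_lt₀ ha', cesaro_power ha⟩
  · have hz : -(1 / p) < ((-(1 / p / 2) : ℝ) : ℂ).re := by rw [Complex.ofReal_re]; linarith
    refine (dense_span_power hz (frequently_nhdsNE_of_isOpen
      (ho.inter (isOpen_lt hn continuous_const : IsOpen {a : ℂ | ‖a + 1‖ < 1}))
      ⟨hz, ?_⟩)).mono (Submodule.span_mono ?_)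
    · rw [mem_ofPred_eq, ← Complex.ofReal_one, ← Complex.ofReal_add, Complex.norm_real,
        Real.norm_of_nonneg (by linarith)]
      linarith
    · rintro _ ⟨a, ⟨ha, ha'⟩, rfl⟩
      exact ⟨_, by
        rw [norm_inv]
        exact (one_lt_inv₀ (norm_pos_iff.2 (add_one_ne_zero ha))).2 ha', cesaro_power ha⟩

theorem dense_periodic_cesaro [hp : Fact (1 < p)] :
    Dense {u : LpLoc p | ∃ n : ℕ, 1 ≤ n ∧ (cesaro p ^ n) u = u} := by
  have hp0 : 0 < p := one_pos.trans hp.out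
  have hpp : 0 < 1 / p := by positivity
  have hz : -(1 / p) < (0 : ℂ).re := by rw [Complex.zero_re]; linarith
  set A : Set ℂ := {a | -(1 / p) < a.re ∧ ∃ n : ℕ, 1 ≤ n ∧ (a + 1) ^ n = 1} with hA
  have hacc : ∃ᶠ a in 𝓝[≠] (0 : ℂ), a ∈ A := by
    set z : ℕ → ℂ := fun n => Complex.exp (2 * Real.pi * Complex.I / ((n + 2 : ℕ) : ℂ)) - 1
    have hprim : ∀ n : ℕ, IsPrimitiveRoot (z n + 1) (n + 2) := fun n => by
      have := Complex.isPrimitiveRoot_exp (n + 2) (by omega)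
      simpa [z] using this
    have hlim : Tendsto z atTop (𝓝 0) := by
      have h1 : Tendsto (fun n : ℕ => 2 * Real.pi * Complex.I / ((n + 2 : ℕ) : ℂ)) atTop (𝓝 0) :=
        (tendsto_const_div_atTop_nhds_zero_nat _).comp (tendsto_add_atTop_nat 2)
      simpa [z] using ((Complex.continuous_exp.tendsto 0).comp h1).sub_const 1
    have hlim' : Tendsto z atTop (𝓝[≠] 0) := by
      refine tendsto_nhdsWithin_iff.2 ⟨hlim, .of_forall fun n h => ?_⟩
      have h1 := (hprim n).ne_one (by omega)
      rw [h, zero_add] at h1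
      exact h1 rfl
    have hre : ∀ᶠ n in atTop, -(1 / p) < (z n).re :=
      ((Complex.continuous_re.tendsto 0).comp hlim).eventually (lt_mem_nhds hz)
    exact hlim'.frequently
      (hre.mono fun n hn => ⟨hn, n + 2, by omega, (hprim n).pow_eq_one⟩).frequently
  refine dense_periodic_of_dense_span _
    ((dense_span_power hz hacc).mono (Submodule.span_mono ?_))
  rintro _ ⟨a, ⟨ha, n, hn, han⟩, rfl⟩
  exact ⟨n, hn, by
    rw [ContinuousLinearMap.pow_apply_of_eigen (cesaro_power ha), inv_pow, han, inv_one, one_smul]⟩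

theorem exists_cesaro_eq_smul [hp : Fact (1 < p)] :
    ∃ (μ : ℝ) (f : LpLoc p), 1 < μ ∧ seminorm p 1 f ≠ 0 ∧ cesaro p f = (μ : ℂ) • f := by
  have hp0 : 0 < p := one_pos.trans hp.out
  have hpp : 0 < 1 / p := by positivity
  have hp1 : 1 / p < 1 := (div_lt_one hp0).2 hp.out
  have hz : -(1 / p) < ((-(1 / p / 2) : ℝ) : ℂ).re := by rw [Complex.ofReal_re]; linarith
  refine ⟨(-(1 / p / 2) + 1)⁻¹, _, (one_lt_inv₀ (by linarith)).2 (by linarith),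
    (seminorm_one_power_pos hz).ne', ?_⟩
  rw [cesaro_power hz]
  push_cast
  rfl

end LpLoc

theorem theorem5p1 (p q : ℝ) [Fact (1 < p)] (hpq : 1 / p + 1 / q = 1) :
    ¬ IsPowerBounded (LpLoc.cesaro p) ∧
    ¬ IsMeanErgodic (LpLoc.cesaro p) ∧
    IsHypercyclic (LpLoc.cesaro p) ∧
    IsChaotic (LpLoc.cesaro p) ∧
    spectrum ℂ (LpLoc.cesaro p) = {μ : ℂ | ‖μ - (q / 2 : ℝ)‖ ≤ q / 2} ∧
    pointSpectrum (LpLoc.cesaro p) = {μ : ℂ | ‖μ - (q / 2 : ℝ)‖ < q / 2} := by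
  have hq : q = p.conjExponent := by
    have h := LpLoc.one_div_conjExponent (p := p)
    have h' : 1 / q = 1 / p.conjExponent := by linarith
    rw [one_div, one_div] at h'
    exact inv_injective h'
  subst hq
  obtain ⟨μ, f, hμ, hf, hT⟩ := LpLoc.exists_cesaro_eq_smul (p := p)
  refine ⟨not_isPowerBounded_of_eigen hT ?_ (LpLoc.continuous_seminorm 1) hf,
    not_isMeanErgodic_of_eigen hT hμ (LpLoc.continuous_seminorm 1) hf, LpLoc.isHypercyclic_cesaro,
    ⟨LpLoc.isHypercyclic_cesaro, LpLoc.dense_periodic_cesaro⟩, LpLoc.spectrum_cesaro,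
    LpLoc.pointSpectrum_cesaro⟩
  rw [Complex.norm_real, Real.norm_eq_abs]
  exact hμ.trans_le (le_abs_self _)
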